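/- **Theorem (Cayley trick for dual volume).** Let $M=\mathbb Z^n$, $M_{\mathbb R}=\mathbb R^n$, and let $q_i=\sum_{\omega\in A_i}c_{i,\omega}x^{\omega}$ ($i=1,\dots,e$) be nonzero real Laurent polynomials in $x=(x_1,\dots,x_n)$ with finite sets of exponents $A_i\subset M$ and all coefficients $c_{i,\omega}>0$. Let $\mathrm{New}(q_i)\subset\mathbb R^n$ be the convex hull of $A_i$. Let $A=\bigcup_{i=1}^e\{(\mathbf e_i,\omega):\omega\in A_i\}\subset\hat M:=\mathbb Z^e\oplus\mathbb Z^n$ be the Cayley configuration, where $\mathbf e_1,\dots,\mathbf e_e$ is the standard basis of $\mathbb Z^e$, and assume that $A$ generates the lattice $\hat M$. Let $\mathrm{Cone}(A)\subset\mathbb R^{e}\oplus\mathbb R^n$ be the set of nonnegative real combinations of $A$. Let $v_1,\dots,v_e>0$ be real numbers, put $P:=\sum_{i=1}^e v_i\,\mathrm{New}(q_i)$ (weighted Minkowski sum), let $u\in\mathbb R^n$ and $X:=(v,u)\in\mathbb R^e\oplus\mathbb R^n$. Notation. For a full-dimensional pointed polyhedral cone $C\subset\mathbb R^d$ and an $X$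 on no hyperplane spanned by a facet of $C$, choose for each facet $F$ of $C$ a linear form $\phi_F$ that is nonnegative on $C$ and defines $F$; let $C^*_X$ be the cone spanned by the vectors $\langle\phi_F,X\rangle\phi_F$, with the standard orientation multiplied by $(-1)^k$, where $k$ is the number of facets with $\langle\phi_F,X\rangle<0$; put $\mathrm{vol}_{\mathbb Z}(C^*_X):=\int_{C^*_X}e^{-\langle\phi,X\rangle}\,d\phi$ (Lebesgue measure normalized by the integer lattice). For a set $\Delta\subset\mathbb R^n$ put $\Delta^\circ:=\{\phi:\langle\phi,p\rangle\ge-1\text{ for all }p\in\Delta\}$, and let $\mathrm{vol}_{\mathbb Z}(\Delta^\circ)$ be $n!$ times the Lebesgue measure of $\Delta^\circ$. 1. The vector $u$ lies in the interior of $P$ if and only if $X$ lies in the interior of $\mathrm{Cone}(A)$. 2. In this case, the following integrals converge (those in the limits for every $\alpha>0$), $(P-u)^\circ$ has finite volume, and $$\begin{aligned} v_1\cdots v_e\,\mathrm{vol}_{\mathbb Z}(\mathrm{Cone}(A)^*_X) &=v_1\cdots v_e\lim_{\alpha\to+0}\alpha^{n+e}\int_{\mathbb R_{>0}^e\times\mathbb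 R_{>0}^n}e^{-\sum_{i=1}^e y_iq_i(x)}\,y^{\alpha v}x^{\alpha u}\,\frac{dy}{y}\frac{dx}{x}\\ &=\lim_{\alpha\to+0}\alpha^{n}\int_{\mathbb R_{>0}^n}\prod_{i=1}^e q_i(x)^{-\alpha v_i}\,x^{\alpha u}\,\frac{dx}{x}\\ &=\mathrm{vol}_{\mathbb Z}((P-u)^\circ). \end{aligned}$$ 3. In this case, call $\sigma\subset A$ a simplex if $|\sigma|=n+e$ and $\det A_\sigma\ne0$, where $A_\sigma$ is the square matrix with the elements of $\sigma$ as columns, and write $p_{\sigma i}(X)$ ($i\in\sigma$) for the entries of $A_\sigma^{-1}X$. Let $T$ be a triangulation of $\mathrm{Cone}(A)$: a set of simplices whose cones cover $\mathrm{Cone}(A)$, with $\mathrm{Cone}(\sigma)\cap\mathrm{Cone}(\tau)=\mathrm{Cone}(\sigma\cap\tau)$ for all $\sigma,\tau\in T$. If $X$ does not lie on the hyperplane spanned by any facet of $\mathrm{Cone}(\sigma)$ for any $\sigma\in T$, then $$\mathrm{vol}_{\mathbb Z}((P-u)^\circ)=v_1\cdots v_e\sum_{\sigma\in T}\frac{1}{\prod_{i\in\sigma}p_{\sigma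 i}(X)}\,\frac{1}{|\det A_\sigma|}.$$ -/

import Mathlib

open MeasureTheory Filter Topology Set
open scoped Pointwise

noncomputable section

namespace CayleyDual

/-- A lattice vector of `ℤ^ι`, regarded as a vector of `ℝ^ι`. -/
def toReal {ι : Type*} (ω : ι → ℤ) : ι → ℝ := fun j => (ω j : ℝ)

/-! ### Laurent polynomials, Newton polytopes, polar duals

The lattice `M` is `ℤ^n`, the real Laurent polynomials are the elements of the group algebra
`ℝ[M]`, `M_ℝ` is `ℝ^n`, and its dual `N_ℝ` is `ℝ^n` through the dot product. -/

/-- A nonzero Laurent polynomial all of whose monomials have positive coefficients. -/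
def IsPositiveLaurent {n : ℕ} (q : AddMonoidAlgebra ℝ (Fin n → ℤ)) : Prop :=
  q ≠ 0 ∧ ∀ ω ∈ q.coeff.support, 0 < q.coeff ω

/-- The value `q(x) = ∑ c_ω x^ω` at a point `x` of the torus. -/
def laurentEval {n : ℕ} (q : AddMonoidAlgebra ℝ (Fin n → ℤ)) (x : Fin n → ℝ) : ℝ :=
  ∑ ω ∈ q.coeff.support, q.coeff ω * ∏ j, x j ^ ω j

/-- The Newton polytope: the convex hull of the exponents of the monomials of `q`. -/
def newton {n : ℕ} (q : AddMonoidAlgebra ℝ (Fin n → ℤ)) : Set (Fin n → ℝ) :=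
  convexHull ℝ (toReal '' (q.coeff.support : Set (Fin n → ℤ)))

/-- The weighted Minkowski sum `v_1 New(q_1) + ⋯ + v_e New(q_e)`. -/
def minkowskiNewton {n e : ℕ} (q : Fin e → AddMonoidAlgebra ℝ (Fin n → ℤ)) (v : Fin e → ℝ) :
    Set (Fin n → ℝ) :=
  ∑ i, v i • newton (q i)

/-- The translate `P - u`. -/
def translate {n : ℕ} (P : Set (Fin n → ℝ)) (u : Fin n → ℝ) : Set (Fin n → ℝ) :=
  (fun p => p - u) '' P

/-- The polar dual `Δ° = {φ | ⟨φ, p⟩ ≥ -1 for all p ∈ Δ}`. -/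
def polarDual {n : ℕ} (Δ : Set (Fin n → ℝ)) : Set (Fin n → ℝ) :=
  {φ | ∀ p ∈ Δ, -1 ≤ φ ⬝ᵥ p}

/-- The normalized volume, `n!` times the Lebesgue measure of `ℝ^n`. -/
def normalizedVolume {n : ℕ} (S : Set (Fin n → ℝ)) : ℝ :=
  (n.factorial : ℝ) * (volume S).toReal

/-! ### Cones and their dual volume -/

section Cones

variable {ι : Type*}

/-- `Cone(A)`, the set of nonnegative real combinations of the vectors of `A`. -/
def cone (A : Finset (ι → ℤ)) : Set (ι → ℝ) :=
  (PointedCone.hull ℝ (toReal '' (A : Set (ι → ℤ))) : Set (ι → ℝ))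

/-- The subset of `C` that is cut out by the linear form `φ`. -/
def faceOf [Fintype ι] (C : Set (ι → ℝ)) (φ : ι → ℝ) : Set (ι → ℝ) :=
  {c ∈ C | φ ⬝ᵥ c = 0}

/-- `φ` is nonnegative on `C` and defines a facet (a face of codimension one) of `C`. -/
def IsFacetNormal [Fintype ι] (C : Set (ι → ℝ)) (φ : ι → ℝ) : Prop :=
  (∀ c ∈ C, 0 ≤ φ ⬝ᵥ c) ∧
    Module.finrank ℝ (Submodule.span ℝ (faceOf C φ)) + 1 =
      Module.finrank ℝ (Submodule.span ℝ C)

/-- The dual cone `C*_X`, spanned by the vectors `⟨φ_F, X⟩ φ_F`, where `F` runs over the facets of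
`C`. (All the normals of a facet are used; each gives the same ray.) -/
def dualCone [Fintype ι] (C : Set (ι → ℝ)) (X : ι → ℝ) : Set (ι → ℝ) :=
  (PointedCone.hull ℝ {ψ : ι → ℝ | ∃ φ, IsFacetNormal C φ ∧ ψ = (φ ⬝ᵥ X) • φ} : Set (ι → ℝ))

/-- The facets `F` of `C` with `⟨φ_F, X⟩ < 0`. -/
def negativeFacets [Fintype ι] (C : Set (ι → ℝ)) (X : ι → ℝ) : Set (Set (ι → ℝ)) :=
  {F | ∃ φ, IsFacetNormal C φ ∧ F = faceOf C φ ∧ φ ⬝ᵥ X < 0}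

/-- The dual volume `vol_ℤ(C*_X)`: the integral of `exp (-⟨φ, X⟩)` over `C*_X`, whose orientation is
the standard one times `-1` to the power of the number of facets with `⟨φ_F, X⟩ < 0`. -/
def dualVolume [Fintype ι] (C : Set (ι → ℝ)) (X : ι → ℝ) : ℝ :=
  (-1) ^ (negativeFacets C X).ncard * ∫ φ in dualCone C X, Real.exp (-(φ ⬝ᵥ X))

/-! ### Triangulations -/

open Classical in
/-- The square matrix `A_σ` whose columns are the vectors of `σ` in some order, when `σ` has as many
elements as there are coordinates (and `0` otherwise). -/
def simplexMatrix [Fintype ι] (σ : Finset (ι → ℤ)) : Matrix ι ι ℝ :=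
  if h : Fintype.card ι = Fintype.card σ then
    Matrix.of fun i k => toReal ((Fintype.equivOfCardEq h k : σ) : ι → ℤ) i
  else 0

open Classical in
/-- A simplex of `A`: a subset `σ` with as many elements as there are coordinates and
`det A_σ ≠ 0`. -/
def IsSimplex [Fintype ι] (A σ : Finset (ι → ℤ)) : Prop :=
  σ ⊆ A ∧ σ.card = Fintype.card ι ∧ (simplexMatrix σ).det ≠ 0

open Classical in
/-- The vector `A_σ⁻¹ X` of the coordinates `p_{σi}(X)` of `X` in the basis `σ`. -/
def simplexCoord [Fintype ι] (σ : Finset (ι → ℤ)) (X : ι → ℝ) : ι → ℝ :=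
  Matrix.mulVec (simplexMatrix σ)⁻¹ X

open Classical in
/-- `|det A_σ|`. -/
def simplexAbsDet [Fintype ι] (σ : Finset (ι → ℤ)) : ℝ := |(simplexMatrix σ).det|

open Classical in
/-- `T` is (the collection of maximal simplices of) a triangulation of `Cone(A)`: the cones of the
simplices cover `Cone(A)`, and any two of them meet in a common face. -/
structure IsTriangulation [Fintype ι] (A : Finset (ι → ℤ)) (T : Finset (Finset (ι → ℤ))) :
    Prop where
  isSimplex : ∀ σ ∈ T, IsSimplex A σ
  cover : ⋃ σ ∈ T, cone σ = cone A
  inter : ∀ σ ∈ T, ∀ τ ∈ T, cone σ ∩ cone τ = cone (σ ∩ τ)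

open Classical in
/-- The hyperplane spanned by the facet of the simplicial cone of `σ` opposite to `ω`. -/
def facetHyperplane (σ : Finset (ι → ℤ)) (ω : ι → ℤ) : Submodule ℝ (ι → ℝ) :=
  Submodule.span ℝ (cone (σ.erase ω))

end Cones

/-! ### The Cayley configuration and the integrals -/

open Classical in
/-- The Cayley configuration `A`, the set of all `(𝐞_i, ω)` in `ℤ^e ⊕ ℤ^n` with `ω` an exponent of
`q_i`. -/
def cayley {n e : ℕ} (q : Fin e → AddMonoidAlgebra ℝ (Fin n → ℤ)) :
    Finset (Fin e ⊕ Fin n → ℤ) :=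
  Finset.univ.biUnion fun i =>
    (q i).coeff.support.image fun ω => Sum.elim (Pi.single i (1 : ℤ)) ω

/-- The open orthant `ℝ_{>0}^m`. -/
def orthant (m : ℕ) : Set (Fin m → ℝ) := {x | ∀ j, 0 < x j}

/-- `exp (-∑ y_i q_i(x)) y^(α v) x^(α u)` times the density `∏ 1/y_i ∏ 1/x_j` of
`dy/y ∧ dx/x` with respect to Lebesgue measure. -/
def expIntegrand {n e : ℕ} (q : Fin e → AddMonoidAlgebra ℝ (Fin n → ℤ)) (v : Fin e → ℝ)
    (u : Fin n → ℝ) (α : ℝ) (z : (Fin e → ℝ) × (Fin n → ℝ)) : ℝ :=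
  Real.exp (-∑ i, z.1 i * laurentEval (q i) z.2) * (∏ i, z.1 i ^ (α * v i)) *
    (∏ j, z.2 j ^ (α * u j)) * ((∏ i, (z.1 i)⁻¹) * ∏ j, (z.2 j)⁻¹)

/-- `∏ q_i(x)^(-α v_i) x^(α u)` times the density `∏ 1/x_j` of `dx/x` with respect to Lebesgue
measure. -/
def powIntegrand {n e : ℕ} (q : Fin e → AddMonoidAlgebra ℝ (Fin n → ℤ)) (v : Fin e → ℝ)
    (u : Fin n → ℝ) (α : ℝ) (x : Fin n → ℝ) : ℝ :=
  (∏ i, laurentEval (q i) x ^ (-(α * v i))) * (∏ j, x j ^ (α * u j)) * ∏ j, (x j)⁻¹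

end CayleyDual

end

namespace CayleyDual

/-! ### Interiors of convex sets and dual cones -/

section ConvexGeometry

variable {ι : Type*} [Fintype ι]

/-! Every quantity is compared with one integral, `∫ exp (-H)` over `ℝ^n`, where `H(y) = ⟨y, u⟩ - ∑
v_i m_i(y)` is `polarGauge` and `m_i(y)` is the minimum of `y` on `New(q_i)`. Minima of a linear
form add under Minkowski sums, so `H(y)` is the maximum of `⟨y, u - p⟩` over `p ∈ P`. Hence `H` is
positive off the origin exactly when `u` is interior to `P`, and `{H ≤ 1}` is the polar dual of `P -
u`; homogeneity of `H` turns `∫ exp (-H)` into `n!` times its volume (`integral_exp_neg_gauge`).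

On the cone side, the forms nonnegative on `Cone(A)` are the pairs `(s, y)` with `s_i ≥ -m_i(y)`,
and `⟨(s, y), X⟩ = ∑ v_i (s_i + m_i(y)) + H(y)`. This splitting gives the equivalence of the two
interior conditions, and integrating out `s` gives `∫ exp (-H)` divided by `∏ v_i`
(`integral_exp_neg_polarCone`). For interior `X` the dual cone is this whole polar cone, because
facet normals generate it (`dualCone_eq_polarCone`).

For the limits, put `x = exp (-y / α)`. Positivity of the coefficients makes `q_i(x)` comparable
with its largest monomial, so up to factors `c ^ (-α v_i)` tending to `1` the integrand is `exp
(-H)`, and the limit follows by squeezing. The variables `y_i` of the exponential integral produce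
`Γ(α v_i)`, and `α v_i Γ(α v_i) = Γ(α v_i + 1)` tends to `1`.

For a triangulation, the indicator of the polar cone is almost everywhere the signed sum of the
indicators of the dual cones of the simplices. With `φ` fixed, this sum is locally constant in `X`
inside `Cone(A)`: when `X` crosses a wall, the changes in the two simplices sharing the wall cancel
(`eventually_sum_signWeight_eq`). It is therefore enough to evaluate it at a convenient point. Each
simplex then contributes an integral that factors in the coordinates `⟨φ, a⟩`, `a ∈ σ`. -/

theorem exists_dotProduct_eq (f : (ι → ℝ) →ₗ[ℝ] ℝ) : ∃ y : ι → ℝ, ∀ x, f x = y ⬝ᵥ x := by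
  classical
  refine ⟨(dotProductEquiv ℝ ι).symm f, fun x => ?_⟩
  exact (LinearMap.congr_fun ((dotProductEquiv ℝ ι).apply_symm_apply f) x).symm

theorem exists_ne_zero_dotProduct_eq_zero {p : Submodule ℝ (ι → ℝ)} (hp : p ≠ ⊤) :
    ∃ y : ι → ℝ, y ≠ 0 ∧ ∀ x ∈ p, y ⬝ᵥ x = 0 := by
  obtain ⟨f, hf, hpf⟩ := Submodule.exists_le_ker_of_lt_top p (lt_top_iff_ne_top.2 hp)
  obtain ⟨y, hy⟩ := exists_dotProduct_eq f
  refine ⟨y, ?_, fun x hx => ?_⟩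
  · rintro rfl
    exact hf (LinearMap.ext fun x => by simp [hy])
  · rw [← hy]
    exact hpf hx

theorem dotProduct_self_pos {y : ι → ℝ} (hy : y ≠ 0) : 0 < y ⬝ᵥ y := by
  have h0 : 0 ≤ y ⬝ᵥ y := Finset.sum_nonneg fun i _ => mul_self_nonneg _
  exact lt_of_le_of_ne h0 fun h => hy (dotProduct_self_eq_zero.1 h.symm)

omit [Fintype ι] in
theorem eventually_add_smul_mem_interior {S : Set (ι → ℝ)} {x : ι → ℝ} (hx : x ∈ interior S)
    (z : ι → ℝ) : ∀ᶠ t : ℝ in 𝓝 0, x + t • z ∈ S := by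
  have hc : ContinuousAt (fun t : ℝ => x + t • z) 0 := by fun_prop
  have : S ∈ 𝓝 (x + (0 : ℝ) • z) := by simpa using mem_interior_iff_mem_nhds.1 hx
  exact hc this

/-- A point is interior to a convex set iff no nonzero linear form is minimized at it. -/
theorem mem_interior_iff_dotProduct {S : Set (ι → ℝ)} (hS : Convex ℝ S) (hne : S.Nonempty)
    (x : ι → ℝ) : x ∈ interior S ↔ ∀ y ≠ 0, ∃ p ∈ S, y ⬝ᵥ p < y ⬝ᵥ x := by
  constructor
  · intro hx y hy
    have h1 : ∀ᶠ t : ℝ in 𝓝[<] 0, x + t • y ∈ S :=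
      (eventually_add_smul_mem_interior hx y).filter_mono nhdsWithin_le_nhds
    obtain ⟨t, ht, ht0⟩ := (h1.and self_mem_nhdsWithin).exists
    refine ⟨_, ht, ?_⟩
    have := dotProduct_self_pos hy
    rw [dotProduct_add, dotProduct_smul, smul_eq_mul]
    have : t * (y ⬝ᵥ y) < 0 := mul_neg_of_neg_of_pos ht0 this
    linarith
  · intro h
    by_contra hx
    -- If the interior is nonempty, separate `x` from it and pass to the closure. Otherwise `S` lies
    -- in a hyperplane, and a form constant on `S` contradicts the assumption applied to both `y`
    -- and `-y`.
    by_cases hi : (interior S).Nonempty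
    · obtain ⟨f, hf⟩ := geometric_hahn_banach_open_point hS.interior isOpen_interior hx
      obtain ⟨y, hy⟩ := exists_dotProduct_eq (f : (ι → ℝ) →ₗ[ℝ] ℝ)
      have hle : ∀ p ∈ S, f p ≤ f x := by
        intro p hp
        have hp' : p ∈ closure (interior S) := by
          rw [hS.closure_interior_eq_closure_of_nonempty_interior hi]
          exact subset_closure hp
        exact closure_minimal (fun a ha => (hf a ha).le)
          (isClosed_le f.continuous continuous_const) hp'
      have hy0 : y ≠ 0 := by
        rintro rfl
        obtain ⟨a, ha⟩ := hi
        have h1 := hf a ha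
        have h2 : f a = 0 := by simpa using hy a
        have h3 : f x = 0 := by simpa using hy x
        linarith
      obtain ⟨p, hp, hlt⟩ := h (-y) (neg_ne_zero.2 hy0)
      have h1 : f p = y ⬝ᵥ p := hy p
      have h2 : f x = y ⬝ᵥ x := hy x
      have := hle p hp
      simp only [neg_dotProduct] at hlt
      linarith
    · rw [hS.interior_nonempty_iff_affineSpan_eq_top] at hi
      have hdir : vectorSpan ℝ S ≠ ⊤ := by
        intro hv
        exact hi
          ((AffineSubspace.affineSpan_eq_top_iff_vectorSpan_eq_top_of_nonempty ℝ _ _ hne).2 hv)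
      obtain ⟨y, hy, hy0⟩ := exists_ne_zero_dotProduct_eq_zero hdir
      obtain ⟨p, hp, hlt⟩ := h y hy
      obtain ⟨p', hp', hlt'⟩ := h (-y) (neg_ne_zero.2 hy)
      have := hy0 _ (vsub_mem_vectorSpan ℝ hp hp')
      simp only [neg_dotProduct, vsub_eq_sub, dotProduct_sub] at *
      linarith

/-- The norm on `ι → ℝ` is the sup norm, so moving by `r` against the sign vector of `y` stays in
the ball and lowers `y` by `r` times its `ℓ¹` norm. -/
theorem exists_ball_subset_dotProduct {S : Set (ι → ℝ)} {x : ι → ℝ} (hx : x ∈ interior S) :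
    ∃ r > 0, ∀ y : ι → ℝ, ∃ p ∈ S, y ⬝ᵥ p = y ⬝ᵥ x - r * ∑ i, |y i| := by
  obtain ⟨r, hr, hb⟩ := Metric.nhds_basis_closedBall.mem_iff.1 (mem_interior_iff_mem_nhds.1 hx)
  refine ⟨r, hr, fun y => ⟨x - r • fun i => (SignType.sign (y i) : ℝ), hb ?_, ?_⟩⟩
  · rw [Metric.mem_closedBall, dist_pi_le_iff hr.le]
    intro i
    have : |((SignType.sign (y i) : SignType) : ℝ)| ≤ 1 := by
      cases SignType.sign (y i) <;> simp
    simp only [Pi.sub_apply, Pi.smul_apply, smul_eq_mul, Real.dist_eq, sub_sub_cancel_left, abs_neg,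
      abs_mul, abs_of_pos hr]
    nlinarith
  · rw [dotProduct_sub, dotProduct_smul, smul_eq_mul]
    congr 2
    exact Finset.sum_congr rfl fun i _ => self_mul_sign (y i)

omit [Fintype ι] in
theorem toReal_mem_cone {A : Finset (ι → ℤ)} {a : ι → ℤ} (ha : a ∈ A) : toReal a ∈ cone A :=
  Submodule.subset_span ⟨a, ha, rfl⟩

omit [Fintype ι] in
theorem convex_cone (A : Finset (ι → ℤ)) : Convex ℝ (cone A) := PointedCone.convex _

omit [Fintype ι] in
theorem zero_mem_cone (A : Finset (ι → ℤ)) : (0 : ι → ℝ) ∈ cone A := Submodule.zero_mem _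

omit [Fintype ι] in
theorem cone_nonempty (A : Finset (ι → ℤ)) : (cone A).Nonempty := ⟨0, zero_mem_cone A⟩

omit [Fintype ι] in
theorem smul_mem_cone {A : Finset (ι → ℤ)} {c : ι → ℝ} (hc : c ∈ cone A) {t : ℝ} (ht : 0 ≤ t) :
    t • c ∈ cone A :=
  Submodule.smul_mem (PointedCone.hull ℝ (toReal '' (A : Set (ι → ℤ)))) (⟨t, ht⟩ : {r : ℝ // 0 ≤ r})
    hc

/-- The dual cone `{φ | ⟨φ, a⟩ ≥ 0 for all a ∈ A}`. -/
def polarCone (A : Finset (ι → ℤ)) : Set (ι → ℝ) := {φ | ∀ a ∈ A, 0 ≤ φ ⬝ᵥ toReal a}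

theorem mem_polarCone_iff {A : Finset (ι → ℤ)} {φ : ι → ℝ} :
    φ ∈ polarCone A ↔ ∀ c ∈ cone A, 0 ≤ φ ⬝ᵥ c := by
  refine ⟨fun h c hc => ?_, fun h a ha => h _ (toReal_mem_cone ha)⟩
  refine Submodule.span_induction (p := fun c _ => 0 ≤ φ ⬝ᵥ c) ?_ ?_ ?_ ?_ hc
  · rintro _ ⟨a, ha, rfl⟩
    exact h a ha
  · simp
  · intro x y _ _ hx hy
    rw [dotProduct_add]
    exact add_nonneg hx hy
  · intro t x _ hx
    have : φ ⬝ᵥ (t • x) = (t : ℝ) * (φ ⬝ᵥ x) := dotProduct_smul (t : ℝ) φ x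
    rw [this]
    exact mul_nonneg t.2 hx

/-- A form outside the polar cone is negative on some generator, and a large multiple of that
generator goes below any value; only forms in the polar cone, whose minimum on the cone is `0`,
impose a condition. -/
theorem mem_interior_cone_iff {A : Finset (ι → ℤ)} {X : ι → ℝ} :
    X ∈ interior (cone A) ↔ ∀ φ ∈ polarCone A, φ ≠ 0 → 0 < φ ⬝ᵥ X := by
  rw [mem_interior_iff_dotProduct (convex_cone A) (cone_nonempty A)]
  constructor
  · intro h φ hφ h0
    obtain ⟨c, hc, hlt⟩ := h φ h0
    exact (mem_polarCone_iff.1 hφ c hc).trans_lt hlt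
  · intro h φ h0
    by_cases hφ : φ ∈ polarCone A
    · exact ⟨0, zero_mem_cone A, by simpa using h φ hφ h0⟩
    · simp only [polarCone, mem_ofPred_eq, not_forall, not_le] at hφ
      obtain ⟨a, ha, hneg⟩ := hφ
      obtain ⟨t, ht0, ht⟩ : ∃ t : ℝ, 0 ≤ t ∧ t * (φ ⬝ᵥ toReal a) < φ ⬝ᵥ X := by
        refine ⟨(|φ ⬝ᵥ X| + 1) / -(φ ⬝ᵥ toReal a), ?_, ?_⟩
        · exact div_nonneg (by positivity) (by linarith)
        · have : (|φ ⬝ᵥ X| + 1) / -(φ ⬝ᵥ toReal a) * (φ ⬝ᵥ toReal a) = -(|φ ⬝ᵥ X| + 1) := by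
            rw [div_neg, neg_mul, div_mul_cancel₀ _ hneg.ne]
          rw [this]
          linarith [neg_abs_le (φ ⬝ᵥ X)]
      exact ⟨t • toReal a, smul_mem_cone (toReal_mem_cone ha) ht0, by
        rwa [dotProduct_smul, smul_eq_mul]⟩

theorem span_cone_eq_top {A : Finset (ι → ℤ)} {X : ι → ℝ} (hX : X ∈ interior (cone A)) :
    Submodule.span ℝ (cone A) = ⊤ := by
  by_contra h
  obtain ⟨y, hy, hy0⟩ := exists_ne_zero_dotProduct_eq_zero h
  have hm : y ∈ polarCone A := mem_polarCone_iff.2 fun c hc => (hy0 c (Submodule.subset_span hc)).ge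
  exact (mem_interior_cone_iff.1 hX y hm hy).ne'
    (hy0 X (Submodule.subset_span (interior_subset hX)))

/-- Tilt `φ` along `ψ` until one more generator becomes tight. Such a generator exists because a
nonzero `ψ` in the polar cone could not vanish at the interior point `X`. Despite the name, the face
cut out by the form grows. -/
theorem exists_smaller_face {A : Finset (ι → ℤ)} {X φ ψ : ι → ℝ} (hX : X ∈ interior (cone A))
    (hφ : φ ∈ polarCone A) (hψ : ψ ≠ 0) (hψX : ψ ⬝ᵥ X = 0)
    (hface : ∀ c ∈ faceOf (cone A) φ, ψ ⬝ᵥ c = 0) :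
    ∃ t : ℝ, 0 < t ∧ φ + t • ψ ∈ polarCone A ∧
      Module.finrank ℝ (Submodule.span ℝ (faceOf (cone A) φ)) <
        Module.finrank ℝ (Submodule.span ℝ (faceOf (cone A) (φ + t • ψ))) := by
  have hex : (A.filter fun a => ψ ⬝ᵥ toReal a < 0).Nonempty := by
    by_contra hne
    have : ψ ∈ polarCone A := fun a ha => by
      by_contra hlt
      exact hne ⟨a, Finset.mem_filter.2 ⟨ha, not_le.1 hlt⟩⟩
    exact (mem_interior_cone_iff.1 hX ψ this hψ).ne' hψX
  -- Ratio test: the least ratio is the first `t` at which the tilted form vanishes on a generator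
  -- where `ψ < 0`, so nonnegativity on the others is kept.
  obtain ⟨b, hb, hmin⟩ :=
    Finset.exists_min_image _ (fun a => (φ ⬝ᵥ toReal a) / -(ψ ⬝ᵥ toReal a)) hex
  rw [Finset.mem_filter] at hb
  obtain ⟨hbA, hbneg⟩ := hb
  have hbpos : 0 < φ ⬝ᵥ toReal b := by
    refine lt_of_le_of_ne (hφ b hbA) fun h0 => ?_
    exact hbneg.ne (hface _ ⟨toReal_mem_cone hbA, h0.symm⟩)
  set t := (φ ⬝ᵥ toReal b) / -(ψ ⬝ᵥ toReal b) with ht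
  have htpos : 0 < t := div_pos hbpos (by linarith)
  have hb0 : (φ + t • ψ) ⬝ᵥ toReal b = 0 := by
    rw [add_dotProduct, smul_dotProduct, smul_eq_mul, ht, div_neg, neg_mul,
      div_mul_cancel₀ _ hbneg.ne, add_neg_cancel]
  refine ⟨t, htpos, fun a ha => ?_, ?_⟩
  · rw [add_dotProduct, smul_dotProduct, smul_eq_mul]
    by_cases hneg : ψ ⬝ᵥ toReal a < 0
    · have := hmin a (Finset.mem_filter.2 ⟨ha, hneg⟩)
      rw [le_div_iff₀ (by linarith)] at this
      linarith
    · exact add_nonneg (hφ a ha) (mul_nonneg htpos.le (not_lt.1 hneg))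
  · refine Submodule.finrank_lt_finrank_of_lt
      (lt_of_le_of_ne (Submodule.span_mono ?_) fun heq => ?_)
    · rintro c ⟨hc, hc0⟩
      refine ⟨hc, ?_⟩
      rw [add_dotProduct, smul_dotProduct, hc0, hface c ⟨hc, hc0⟩, smul_zero, add_zero]
    · have hbm : toReal b ∈ Submodule.span ℝ (faceOf (cone A) φ) := by
        rw [heq]
        exact Submodule.subset_span ⟨toReal_mem_cone hbA, hb0⟩
      refine hbneg.ne (Submodule.span_induction (p := fun c _ => ψ ⬝ᵥ c = 0) hface ?_ ?_ ?_ hbm)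
      · simp
      · intro x y _ _ hx hy
        rw [dotProduct_add, hx, hy, add_zero]
      · intro s x _ hx
        rw [dotProduct_smul, hx, smul_zero]

/-- Induction on a bound `k` for the codimension of the span of the face cut out by `φ`. Codimension
`0` forces `φ = 0`, codimension `1` means a facet normal, and in higher codimension `φ` lies
strictly between two forms with larger faces. -/
theorem mem_dualCone_of_mem_polarCone {A : Finset (ι → ℤ)} {X : ι → ℝ}
    (hX : X ∈ interior (cone A)) (k : ℕ) : ∀ φ ∈ polarCone A,
      Fintype.card ι ≤ k + Module.finrank ℝ (Submodule.span ℝ (faceOf (cone A) φ)) →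
      φ ∈ dualCone (cone A) X := by
  have hhull : ∀ {s t : ℝ} {φ ψ : ι → ℝ}, 0 ≤ s → 0 ≤ t → φ ∈ dualCone (cone A) X →
      ψ ∈ dualCone (cone A) X → s • φ + t • ψ ∈ dualCone (cone A) X := by
    intro s t φ ψ hs ht hφ hψ
    exact Submodule.add_mem (PointedCone.hull ℝ _)
      (Submodule.smul_mem (PointedCone.hull ℝ _) (⟨s, hs⟩ : {r : ℝ // 0 ≤ r}) hφ)
      (Submodule.smul_mem (PointedCone.hull ℝ _) (⟨t, ht⟩ : {r : ℝ // 0 ≤ r}) hψ)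
  induction k with
  | zero =>
    intro φ hφ hk
    have htop : Submodule.span ℝ (faceOf (cone A) φ) = ⊤ := by
      apply Submodule.eq_top_of_finrank_eq
      refine le_antisymm (Submodule.finrank_le _) ?_
      simpa using hk
    have h0 : φ = 0 := by
      by_contra hne
      have hm : φ ∈ Submodule.span ℝ (faceOf (cone A) φ) := htop ▸ Submodule.mem_top
      refine (dotProduct_self_pos hne).ne' (Submodule.span_induction
        (p := fun c _ => φ ⬝ᵥ c = 0) (fun c hc => hc.2) ?_ ?_ ?_ hm)
      · simp
      · intro x y _ _ hx hy
        rw [dotProduct_add, hx, hy, add_zero]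
      · intro s x _ hx
        rw [dotProduct_smul, hx, smul_zero]
    rw [h0]
    exact Submodule.zero_mem (PointedCone.hull ℝ _)
  | succ k ih =>
    intro φ hφ hk
    rcases hk.lt_or_eq with hlt | heq
    · exact ih φ hφ (by omega)
    by_cases hφ0 : φ = 0
    · rw [hφ0]
      exact Submodule.zero_mem (PointedCone.hull ℝ _)
    have hφX := mem_interior_cone_iff.1 hX φ hφ hφ0
    rcases Nat.eq_zero_or_pos k with rfl | hkpos
    · have hfac : IsFacetNormal (cone A) φ := by
        refine ⟨mem_polarCone_iff.1 hφ, ?_⟩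
        rw [span_cone_eq_top hX, finrank_top, Module.finrank_fintype_fun_eq_card]
        omega
      have hmem : (φ ⬝ᵥ X) • φ ∈ dualCone (cone A) X :=
        Submodule.subset_span ⟨φ, hfac, rfl⟩
      have := hhull (inv_nonneg.2 hφX.le) le_rfl hmem hmem
      rwa [zero_smul, add_zero, smul_smul, inv_mul_cancel₀ hφX.ne', one_smul] at this
    -- In codimension at least two the face and `X` together do not span, so some nonzero `ψ`
    -- vanishes on both and `φ` can be tilted along `ψ` and along `-ψ`.
    · have hne : Submodule.span ℝ (faceOf (cone A) φ) ⊔ Submodule.span ℝ {X} ≠ ⊤ := by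
        intro htop
        have h1 := Submodule.finrank_add_le_finrank_add_finrank
          (Submodule.span ℝ (faceOf (cone A) φ)) (Submodule.span ℝ {X})
        rw [htop, finrank_top, Module.finrank_fintype_fun_eq_card] at h1
        have h2 : Module.finrank ℝ (Submodule.span ℝ ({X} : Set (ι → ℝ))) ≤ 1 := by
          simpa using finrank_span_le_card (R := ℝ) ({X} : Set (ι → ℝ))
        omega
      obtain ⟨ψ, hψ, hψ0⟩ := exists_ne_zero_dotProduct_eq_zero hne
      have hψX : ψ ⬝ᵥ X = 0 :=
        hψ0 X (Submodule.mem_sup_right (Submodule.mem_span_singleton_self X))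
      have hψF : ∀ c ∈ faceOf (cone A) φ, ψ ⬝ᵥ c = 0 := fun c hc =>
        hψ0 c (Submodule.mem_sup_left (Submodule.subset_span hc))
      obtain ⟨t, ht, htm, htr⟩ := exists_smaller_face hX hφ hψ hψX hψF
      obtain ⟨s, hs, hsm, hsr⟩ := exists_smaller_face hX hφ (neg_ne_zero.2 hψ)
        (by rw [neg_dotProduct, hψX, neg_zero])
        (fun c hc => by rw [neg_dotProduct, hψF c hc, neg_zero])
      -- These weights sum to `1` and cancel `ψ` between `φ + t ψ` and `φ - s ψ`.
      have h := hhull (s := s / (s + t)) (t := t / (s + t)) (by positivity) (by positivity)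
        (ih _ htm (by omega)) (ih _ hsm (by omega))
      convert h using 1
      ext i
      simp only [Pi.add_apply, Pi.smul_apply, Pi.neg_apply, smul_eq_mul]
      field_simp
      ring

/-- For an interior point `X`, the facet normals of a cone span its whole dual cone. -/
theorem dualCone_eq_polarCone {A : Finset (ι → ℤ)} {X : ι → ℝ} (hX : X ∈ interior (cone A)) :
    dualCone (cone A) X = polarCone A := by
  apply Subset.antisymm
  · intro φ hφ
    refine Submodule.span_induction (p := fun φ _ => φ ∈ polarCone A) ?_ ?_ ?_ ?_ hφ
    · rintro _ ⟨φ, hφ, rfl⟩ a ha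
      rw [smul_dotProduct]
      exact mul_nonneg (hφ.1 X (interior_subset hX)) (hφ.1 _ (toReal_mem_cone ha))
    · intro a _
      simp
    · intro x y _ _ hx hy a ha
      rw [add_dotProduct]
      exact add_nonneg (hx a ha) (hy a ha)
    · intro t x _ hx a ha
      have : (t • x) ⬝ᵥ toReal a = (t : ℝ) * (x ⬝ᵥ toReal a) := smul_dotProduct (t : ℝ) x _
      rw [this]
      exact mul_nonneg t.2 (hx a ha)
  · exact fun φ hφ => mem_dualCone_of_mem_polarCone hX (Fintype.card ι) φ hφ (by omega)

theorem dualVolume_eq_integral_polarCone {A : Finset (ι → ℤ)} {X : ι → ℝ}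
    (hX : X ∈ interior (cone A)) :
    dualVolume (cone A) X = ∫ φ in polarCone A, Real.exp (-(φ ⬝ᵥ X)) := by
  have h : negativeFacets (cone A) X = ∅ := by
    rw [eq_empty_iff_forall_notMem]
    rintro F ⟨φ, hφ, -, hneg⟩
    exact (hφ.1 X (interior_subset hX)).not_gt hneg
  rw [dualVolume, h, ncard_empty, pow_zero, one_mul, dualCone_eq_polarCone hX]

theorem measurableSet_polarCone (A : Finset (ι → ℤ)) : MeasurableSet (polarCone A) := by
  have : polarCone A = ⋂ a ∈ A, {φ | 0 ≤ φ ⬝ᵥ toReal a} := by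
    ext φ
    simp [polarCone]
  rw [this]
  refine Finset.measurableSet_biInter _ fun a _ => measurableSet_le measurable_const ?_
  exact (Continuous.dotProduct continuous_id continuous_const).measurable

end ConvexGeometry

/-! ### Support functions of Newton polytopes -/

section Newton

variable {n e : ℕ}

/-- The minimum of the linear form `y` on the Newton polytope of `q`. -/
noncomputable def newtonMin (q : AddMonoidAlgebra ℝ (Fin n → ℤ)) (y : Fin n → ℝ) : ℝ :=
  ⨅ ω : q.coeff.support, y ⬝ᵥ toReal (ω : Fin n → ℤ)

/-- The gauge `y ↦ max_{p ∈ P - u} ⟨y, -p⟩` of the polar dual of `P - u`. -/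
noncomputable def polarGauge (q : Fin e → AddMonoidAlgebra ℝ (Fin n → ℤ)) (v : Fin e → ℝ)
    (u : Fin n → ℝ) (y : Fin n → ℝ) : ℝ :=
  y ⬝ᵥ u - ∑ i, v i * newtonMin (q i) y

theorem IsPositiveLaurent.nonempty_support {q : AddMonoidAlgebra ℝ (Fin n → ℤ)}
    (hq : IsPositiveLaurent q) : q.coeff.support.Nonempty := by
  rw [Finsupp.support_nonempty_iff]
  intro h
  exact hq.1 (by ext; simp [h])

theorem newtonMin_le {q : AddMonoidAlgebra ℝ (Fin n → ℤ)} (y : Fin n → ℝ) {ω : Fin n → ℤ}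
    (hω : ω ∈ q.coeff.support) : newtonMin q y ≤ y ⬝ᵥ toReal ω :=
  ciInf_le (f := fun ω : q.coeff.support => y ⬝ᵥ toReal (ω : Fin n → ℤ))
    (Set.finite_range _).bddBelow ⟨ω, hω⟩

theorem exists_newtonMin_eq {q : AddMonoidAlgebra ℝ (Fin n → ℤ)} (hq : IsPositiveLaurent q)
    (y : Fin n → ℝ) : ∃ ω ∈ q.coeff.support, y ⬝ᵥ toReal ω = newtonMin q y := by
  have : Nonempty q.coeff.support := hq.nonempty_support.to_subtype
  obtain ⟨ω, hω⟩ := exists_eq_ciInf_of_finite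
    (f := fun ω : q.coeff.support => y ⬝ᵥ toReal (ω : Fin n → ℤ))
  exact ⟨ω, ω.2, hω⟩

theorem measurable_newtonMin (q : AddMonoidAlgebra ℝ (Fin n → ℤ)) : Measurable (newtonMin q) :=
  Measurable.iInf fun _ => (Continuous.dotProduct continuous_id continuous_const).measurable

theorem newtonMin_smul {q : AddMonoidAlgebra ℝ (Fin n → ℤ)} {t : ℝ} (ht : 0 ≤ t)
    (y : Fin n → ℝ) : newtonMin q (t • y) = t * newtonMin q y := by
  simp only [newtonMin, smul_dotProduct, smul_eq_mul]
  exact (Real.mul_iInf_of_nonneg ht _).symm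

theorem measurable_polarGauge (q : Fin e → AddMonoidAlgebra ℝ (Fin n → ℤ)) (v : Fin e → ℝ)
    (u : Fin n → ℝ) : Measurable (polarGauge q v u) :=
  (Continuous.dotProduct continuous_id continuous_const).measurable.sub
    (Finset.measurable_sum _ fun i _ => (measurable_newtonMin (q i)).const_mul (v i))

theorem polarGauge_smul (q : Fin e → AddMonoidAlgebra ℝ (Fin n → ℤ)) (v : Fin e → ℝ)
    (u : Fin n → ℝ) {t : ℝ} (ht : 0 ≤ t) (y : Fin n → ℝ) :
    polarGauge q v u (t • y) = t * polarGauge q v u y := by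
  simp only [polarGauge, newtonMin_smul ht, smul_dotProduct, smul_eq_mul, mul_sub, Finset.mul_sum]
  congr 1
  exact Finset.sum_congr rfl fun i _ => by ring

theorem newtonMin_le_of_mem_newton {q : AddMonoidAlgebra ℝ (Fin n → ℤ)} (y : Fin n → ℝ)
    {p : Fin n → ℝ} (hp : p ∈ newton q) : newtonMin q y ≤ y ⬝ᵥ p := by
  have hconv : Convex ℝ {p : Fin n → ℝ | newtonMin q y ≤ y ⬝ᵥ p} :=
    convex_halfSpace_ge ⟨fun a b => dotProduct_add y a b, fun t a => dotProduct_smul t y a⟩ _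
  refine convexHull_min ?_ hconv hp
  rintro _ ⟨ω, hω, rfl⟩
  exact newtonMin_le y hω

variable {q : Fin e → AddMonoidAlgebra ℝ (Fin n → ℤ)} {v : Fin e → ℝ}

theorem convex_minkowskiNewton (q : Fin e → AddMonoidAlgebra ℝ (Fin n → ℤ)) (v : Fin e → ℝ) :
    Convex ℝ (minkowskiNewton q v) :=
  convex_sum _ fun i _ => (convex_convexHull ℝ _).smul (v i)

theorem sum_newtonMin_le (hv : ∀ i, 0 < v i) (y : Fin n → ℝ) {p : Fin n → ℝ}
    (hp : p ∈ minkowskiNewton q v) : ∑ i, v i * newtonMin (q i) y ≤ y ⬝ᵥ p := by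
  obtain ⟨g, hg, rfl⟩ := (Set.mem_finsetSum _ _ _).1 hp
  rw [dotProduct_sum]
  refine Finset.sum_le_sum fun i hi => ?_
  obtain ⟨x, hx, hxg⟩ := Set.mem_smul_set.1 (hg hi)
  rw [← hxg, dotProduct_smul, smul_eq_mul]
  exact mul_le_mul_of_nonneg_left (newtonMin_le_of_mem_newton y hx) (hv i).le

theorem exists_mem_minkowskiNewton (hq : ∀ i, IsPositiveLaurent (q i)) (v : Fin e → ℝ)
    (y : Fin n → ℝ) : ∃ p ∈ minkowskiNewton q v, y ⬝ᵥ p = ∑ i, v i * newtonMin (q i) y := by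
  choose ω hω hmin using fun i => exists_newtonMin_eq (hq i) y
  refine ⟨∑ i, v i • toReal (ω i), (Set.mem_finsetSum _ _ _).2 ⟨_, fun {i} _ => ?_, rfl⟩, ?_⟩
  · exact Set.smul_mem_smul_set (subset_convexHull ℝ _ ⟨_, hω i, rfl⟩)
  · simp only [dotProduct_sum, dotProduct_smul, smul_eq_mul, hmin]

theorem mem_interior_minkowskiNewton_iff (hq : ∀ i, IsPositiveLaurent (q i)) (hv : ∀ i, 0 < v i)
    (u : Fin n → ℝ) :
    u ∈ interior (minkowskiNewton q v) ↔ ∀ y ≠ 0, 0 < polarGauge q v u y := by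
  obtain ⟨p₀, hp₀, -⟩ := exists_mem_minkowskiNewton hq v 0
  rw [mem_interior_iff_dotProduct (convex_minkowskiNewton q v) ⟨p₀, hp₀⟩]
  refine forall₂_congr fun y _ => ⟨?_, fun h => ?_⟩
  · rintro ⟨p, hp, hlt⟩
    exact sub_pos.2 ((sum_newtonMin_le hv y hp).trans_lt hlt)
  · obtain ⟨p, hp, hpy⟩ := exists_mem_minkowskiNewton hq v y
    exact ⟨p, hp, hpy ▸ sub_pos.1 h⟩

theorem exists_polarGauge_ge (hv : ∀ i, 0 < v i) {u : Fin n → ℝ}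
    (hu : u ∈ interior (minkowskiNewton q v)) :
    ∃ r > 0, ∀ y, r * ∑ j, |y j| ≤ polarGauge q v u y := by
  obtain ⟨r, hr, h⟩ := exists_ball_subset_dotProduct hu
  refine ⟨r, hr, fun y => ?_⟩
  obtain ⟨p, hp, hpy⟩ := h y
  have := sum_newtonMin_le hv y hp
  rw [polarGauge]
  linarith

theorem polarDual_translate_eq (hq : ∀ i, IsPositiveLaurent (q i)) (hv : ∀ i, 0 < v i)
    (u : Fin n → ℝ) :
    polarDual (translate (minkowskiNewton q v) u) = {y | polarGauge q v u y ≤ 1} := by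
  ext y
  simp only [polarDual, translate, mem_ofPred_eq, forall_mem_image, dotProduct_sub, polarGauge]
  constructor
  · intro h
    obtain ⟨p, hp, hpy⟩ := exists_mem_minkowskiNewton hq v y
    have := h hp
    linarith
  · intro h p hp
    have := sum_newtonMin_le hv y hp
    linarith

theorem cayley_dotProduct (φ : Fin e ⊕ Fin n → ℝ) (i : Fin e) (ω : Fin n → ℤ) :
    φ ⬝ᵥ toReal (Sum.elim (Pi.single i (1 : ℤ)) ω) =
      φ (Sum.inl i) + (fun j => φ (Sum.inr j)) ⬝ᵥ toReal ω := by
  simp only [dotProduct, toReal, Fintype.sum_sum_type, Sum.elim_inl, Sum.elim_inr]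
  congr 1
  rw [Finset.sum_eq_single i]
  · simp
  · intro k _ hk
    simp [Pi.single_eq_of_ne hk]
  · simp

/-- For fixed `y` the inequalities `s_i + ⟨y, ω⟩ ≥ 0`, over all exponents `ω` of `q_i`, reduce to
the one for the minimizing `ω`. The polar cone thus fibres over `ℝ^n` in products of half-lines. -/
theorem mem_polarCone_cayley_iff (hq : ∀ i, IsPositiveLaurent (q i)) (φ : Fin e ⊕ Fin n → ℝ) :
    φ ∈ polarCone (cayley q) ↔
      ∀ i, -newtonMin (q i) (fun j => φ (Sum.inr j)) ≤ φ (Sum.inl i) := by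
  constructor
  · intro h i
    obtain ⟨ω, hω, hmin⟩ := exists_newtonMin_eq (hq i) fun j => φ (Sum.inr j)
    have := h (Sum.elim (Pi.single i (1 : ℤ)) ω) (Finset.mem_biUnion.2
      ⟨i, Finset.mem_univ i, Finset.mem_image_of_mem _ hω⟩)
    rw [cayley_dotProduct, hmin] at this
    linarith
  · intro h a ha
    obtain ⟨i, -, hi⟩ := Finset.mem_biUnion.1 ha
    obtain ⟨ω, hω, rfl⟩ := Finset.mem_image.1 hi
    rw [cayley_dotProduct]
    have := newtonMin_le (fun j => φ (Sum.inr j)) hω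
    have := h i
    linarith

theorem mem_interior_iff_mem_interior_cone (hq : ∀ i, IsPositiveLaurent (q i))
    (hv : ∀ i, 0 < v i) (u : Fin n → ℝ) :
    u ∈ interior (minkowskiNewton q v) ↔ Sum.elim v u ∈ interior (cone (cayley q)) := by
  rw [mem_interior_minkowskiNewton_iff hq hv, mem_interior_cone_iff]
  have hdot : ∀ φ : Fin e ⊕ Fin n → ℝ, φ ⬝ᵥ Sum.elim v u =
      ∑ i, v i * (φ (Sum.inl i) + newtonMin (q i) fun j => φ (Sum.inr j)) +
        polarGauge q v u fun j => φ (Sum.inr j) := by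
    intro φ
    simp only [dotProduct, Fintype.sum_sum_type, Sum.elim_inl, Sum.elim_inr, polarGauge, mul_add,
      Finset.sum_add_distrib, mul_comm (φ _) (v _)]
    ring
  constructor
  · intro h φ hφ h0
    rw [mem_polarCone_cayley_iff hq] at hφ
    have hnn : ∀ i ∈ Finset.univ,
        0 ≤ v i * (φ (Sum.inl i) + newtonMin (q i) fun j => φ (Sum.inr j)) := fun i _ =>
      mul_nonneg (hv i).le (by linarith [hφ i])
    rw [hdot]
    -- Over `y = 0` the gauge term vanishes, so positivity has to come from `∑ v_i s_i` with `s ≥ 0`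
    -- and `s ≠ 0`; over `y ≠ 0` the gauge already gives it.
    by_cases hy : (fun j => φ (Sum.inr j)) = 0
    · have hmin : ∀ i, newtonMin (q i) (fun j => φ (Sum.inr j)) = 0 := fun i => by
        obtain ⟨ω, -, hω⟩ := exists_newtonMin_eq (hq i) fun j => φ (Sum.inr j)
        rw [← hω, hy, zero_dotProduct]
      have hg : polarGauge q v u (fun j => φ (Sum.inr j)) = 0 := by
        simp only [polarGauge, hmin]
        simp [hy]
      rw [hg, add_zero]
      refine lt_of_le_of_ne (Finset.sum_nonneg hnn) fun hs => h0 ?_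
      have hz := (Finset.sum_eq_zero_iff_of_nonneg hnn).1 hs.symm
      ext (i | j)
      · have := hz i (Finset.mem_univ i)
        rw [hmin, add_zero] at this
        exact (mul_eq_zero.1 this).resolve_left (hv i).ne'
      · exact congrFun hy j
    · exact add_pos_of_nonneg_of_pos (Finset.sum_nonneg hnn) (h _ hy)
  · intro h y hy
    -- The lowest point of the fibre over `y`: there every `v_i (s_i + m_i(y))` vanishes and the
    -- pairing with `X` is exactly the gauge.
    have := h (Sum.elim (fun i => -newtonMin (q i) y) y)
      ((mem_polarCone_cayley_iff hq _).2 fun i => le_rfl)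
      (fun h0 => hy (funext fun j => congrFun h0 (Sum.inr j)))
    rw [hdot] at this
    simpa using this

end Newton

/-! ### The integrals -/

section Integrals

theorem integrable_and_integral_prod_of_nonneg {α β : Type*} [MeasurableSpace α]
    [MeasurableSpace β] {μ : Measure α} {ν : Measure β} [SFinite μ] [SFinite ν]
    {f : α × β → ℝ} {g : β → ℝ} (hf : AEStronglyMeasurable f (μ.prod ν))
    (h : ∀ᵐ y ∂ν, (0 ≤ᵐ[μ] fun x => f (x, y)) ∧ Integrable (fun x => f (x, y)) μ ∧
      ∫ x, f (x, y) ∂μ = g y) (hg : Integrable g ν) :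
    Integrable f (μ.prod ν) ∧ ∫ z, f z ∂μ.prod ν = ∫ y, g y ∂ν := by
  have hint : Integrable f (μ.prod ν) := by
    rw [integrable_prod_iff' hf]
    refine ⟨h.mono fun y hy => hy.2.1, hg.congr ?_⟩
    filter_upwards [h] with y hy
    rw [← hy.2.2]
    refine integral_congr_ae ?_
    filter_upwards [hy.1] with x hx
    exact (Real.norm_of_nonneg hx).symm
  refine ⟨hint, ?_⟩
  rw [integral_prod_symm f hint]
  exact integral_congr_ae (h.mono fun y hy => hy.2.2)

theorem integrable_and_integral_exp_neg_Ici {v : ℝ} (hv : 0 < v) (m : ℝ) :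
    Integrable (fun s : ℝ => if -m ≤ s then Real.exp (-(s * v)) else 0) ∧
      ∫ s : ℝ, (if -m ≤ s then Real.exp (-(s * v)) else 0) = v⁻¹ * Real.exp (v * m) := by
  have hrw : (fun s : ℝ => if -m ≤ s then Real.exp (-(s * v)) else 0) =
      (Ici (-m)).indicator fun s => Real.exp (-v * s) := by
    ext s
    simp only [indicator, mem_Ici]
    congr 2
    ring
  have hval : ∫ s in Ici (-m), Real.exp (-v * s) = v⁻¹ * Real.exp (v * m) := by
    rw [integral_Ici_eq_integral_Ioi, integral_exp_mul_Ioi (neg_neg_of_pos hv)]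
    rw [neg_div_neg_eq, neg_mul_neg]
    ring
  rw [hrw, integral_indicator measurableSet_Ici, integrable_indicator_iff measurableSet_Ici]
  refine ⟨?_, hval⟩
  -- The integral of a non-integrable function is `0` by convention, so its positive value proves
  -- integrability.
  refine Integrable.of_integral_ne_zero ?_
  rw [hval]
  positivity

variable {n e : ℕ}

theorem integral_exp_neg_polarCone {q : Fin e → AddMonoidAlgebra ℝ (Fin n → ℤ)}
    (hq : ∀ i, IsPositiveLaurent (q i)) {v : Fin e → ℝ} (hv : ∀ i, 0 < v i) (u : Fin n → ℝ)
    (hH : Integrable fun y => Real.exp (-polarGauge q v u y)) :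
    IntegrableOn (fun φ : Fin e ⊕ Fin n → ℝ => Real.exp (-(φ ⬝ᵥ Sum.elim v u)))
        (polarCone (cayley q)) ∧
      (∏ i, v i) * ∫ φ in polarCone (cayley q), Real.exp (-(φ ⬝ᵥ Sum.elim v u)) =
        ∫ y, Real.exp (-polarGauge q v u y) := by
  let F : (Fin e → ℝ) × (Fin n → ℝ) → ℝ := fun z =>
    (∏ i, if -newtonMin (q i) z.2 ≤ z.1 i then Real.exp (-(z.1 i * v i)) else 0) *
      Real.exp (-(z.2 ⬝ᵥ u))
  have hFm : Measurable F := by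
    refine Measurable.mul (Finset.measurable_prod _ fun i _ => ?_) ?_
    · refine Measurable.ite (measurableSet_le ?_ ?_) ?_ measurable_const
      · exact ((measurable_newtonMin (q i)).comp measurable_snd).neg
      · fun_prop
      · fun_prop
    · have : Continuous fun z : (Fin e → ℝ) × (Fin n → ℝ) => Real.exp (-(z.2 ⬝ᵥ u)) :=
        Real.continuous_exp.comp (Continuous.dotProduct continuous_snd continuous_const).neg
      exact this.measurable
  have hFE : ∀ φ : Fin e ⊕ Fin n → ℝ,
      (polarCone (cayley q)).indicator (fun φ => Real.exp (-(φ ⬝ᵥ Sum.elim v u))) φ =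
        F (MeasurableEquiv.sumPiEquivProdPi (fun _ => ℝ) φ) := by
    intro φ
    have hE : F (MeasurableEquiv.sumPiEquivProdPi (fun _ => ℝ) φ) =
      (∏ i, if -newtonMin (q i) (fun j => φ (Sum.inr j)) ≤ φ (Sum.inl i) then
        Real.exp (-(φ (Sum.inl i) * v i)) else 0) *
          Real.exp (-((fun j => φ (Sum.inr j)) ⬝ᵥ u)) := rfl
    rw [hE]
    by_cases hφ : φ ∈ polarCone (cayley q)
    · rw [indicator_of_mem hφ]
      rw [mem_polarCone_cayley_iff hq] at hφ
      rw [Finset.prod_congr rfl fun i _ => if_pos (hφ i), ← Real.exp_sum, ← Real.exp_add]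
      congr 1
      simp only [dotProduct, Fintype.sum_sum_type, Sum.elim_inl, Sum.elim_inr,
        Finset.sum_neg_distrib]
      ring
    · rw [indicator_of_notMem hφ]
      rw [mem_polarCone_cayley_iff hq] at hφ
      push Not at hφ
      obtain ⟨i, hi⟩ := hφ
      rw [Finset.prod_eq_zero (Finset.mem_univ i) (if_neg hi.not_ge), zero_mul]
  have hfub := integrable_and_integral_prod_of_nonneg (μ := volume) (ν := volume)
    (g := fun y => (∏ i, (v i)⁻¹) * Real.exp (-polarGauge q v u y))
    hFm.aestronglyMeasurable (Eventually.of_forall fun y => ⟨?_, ?_, ?_⟩) (hH.const_mul _)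
  · have hmp := volume_measurePreserving_sumPiEquivProdPi fun _ : Fin e ⊕ Fin n => ℝ
    constructor
    · rw [← integrable_indicator_iff (measurableSet_polarCone _)]
      rw [show (polarCone (cayley q)).indicator (fun φ => Real.exp (-(φ ⬝ᵥ Sum.elim v u))) =
        F ∘ MeasurableEquiv.sumPiEquivProdPi (fun _ => ℝ) from funext hFE]
      exact (hmp.integrable_comp_emb (MeasurableEquiv.measurableEmbedding _)).2 hfub.1
    · rw [← integral_indicator (measurableSet_polarCone _)]
      simp_rw [hFE]
      rw [hmp.integral_comp (MeasurableEquiv.measurableEmbedding _) F]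
      have h2 : ∫ z, F z = ∫ y, (∏ i, (v i)⁻¹) * Real.exp (-polarGauge q v u y) := hfub.2
      rw [h2, integral_const_mul, ← mul_assoc, ← Finset.prod_mul_distrib,
        Finset.prod_eq_one fun i _ => mul_inv_cancel₀ (hv i).ne', one_mul]
  · refine Eventually.of_forall fun s => ?_
    exact mul_nonneg (Finset.prod_nonneg fun i _ => by split_ifs <;> positivity) (by positivity)
  · have h := Integrable.fintype_prod fun i =>
      (integrable_and_integral_exp_neg_Ici (hv i) (newtonMin (q i) y)).1
    exact h.mul_const (Real.exp (-(y ⬝ᵥ u)))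
  · simp only [F]
    rw [integral_mul_const, integral_fintype_prod_volume_eq_prod fun i s =>
      if -newtonMin (q i) y ≤ s then Real.exp (-(s * v i)) else 0,
      Finset.prod_congr rfl fun i _ =>
        (integrable_and_integral_exp_neg_Ici (hv i) (newtonMin (q i) y)).2,
      Finset.prod_mul_distrib, mul_assoc, ← Real.exp_sum, ← Real.exp_add, polarGauge]
    congr 2
    ring

/-- The integral of `exp (-H)` for a positively homogeneous `H` in terms of the volume of
`{H ≤ 1}`. -/
theorem integral_exp_neg_gauge {H : (Fin n → ℝ) → ℝ} (hm : Measurable H) (h0 : ∀ y, 0 ≤ H y)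
    (hhom : ∀ t : ℝ, 0 ≤ t → ∀ y, H (t • y) = t * H y) (hfin : volume {y | H y ≤ 1} < ⊤) :
    Integrable (fun y => Real.exp (-H y)) ∧
      ∫ y, Real.exp (-H y) = n.factorial * (volume {y | H y ≤ 1}).toReal := by
  -- Layer cake: `exp (-H y)` is the integral of `exp (-t)` over `t ≥ H y`. Exchanging the order
  -- leaves `∫ exp (-t) vol {H ≤ t} dt` with `vol {H ≤ t} = t^n vol {H ≤ 1}`, a Gamma integral at `n
  -- + 1`.
  let F : (Fin n → ℝ) × ℝ → ℝ := fun z => if H z.1 ≤ z.2 then Real.exp (-z.2) else 0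
  have hFm : Measurable F :=
    Measurable.ite (measurableSet_le (hm.comp measurable_fst) measurable_snd) (by fun_prop)
      measurable_const
  have hset : ∀ t : ℝ, 0 < t → volume {y | H y ≤ t} =
      ENNReal.ofReal (t ^ n) * volume {y | H y ≤ 1} := by
    intro t ht
    have hs : {y | H y ≤ t} = t • {y | H y ≤ 1} := by
      ext y
      rw [mem_smul_set_iff_inv_smul_mem₀ ht.ne', mem_ofPred_eq, mem_ofPred_eq,
        hhom _ (inv_nonneg.2 ht.le), inv_mul_le_one₀ ht]
    rw [hs, Measure.addHaar_smul, Module.finrank_fin_fun, abs_of_pos (pow_pos ht n)]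
  have hmeas : ∀ t : ℝ, MeasurableSet {y | H y ≤ t} := fun t => measurableSet_le hm measurable_const
  have hlt : ∀ t : ℝ, 0 < t → volume {y | H y ≤ t} < ⊤ := fun t ht => by
    rw [hset t ht]
    exact ENNReal.mul_lt_top ENNReal.ofReal_lt_top hfin
  have hind : ∀ t : ℝ, (fun y => F (y, t)) = {y | H y ≤ t}.indicator fun _ => Real.exp (-t) :=
    fun t => rfl
  have hn : (0 : ℝ) < n + 1 := by positivity
  have hfub := integrable_and_integral_prod_of_nonneg (μ := (volume : Measure (Fin n → ℝ)))
    (ν := volume.restrict (Ioi (0 : ℝ)))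
    (g := fun t => Real.exp (-t) * t ^ ((n + 1 : ℝ) - 1) * (volume {y | H y ≤ 1}).toReal)
    hFm.aestronglyMeasurable ?_ ((Real.GammaIntegral_convergent hn).mul_const _)
  · have hinner : ∀ y, ∫ t in Ioi 0, F (y, t) = Real.exp (-H y) := by
      intro y
      have : (fun t => F (y, t)) = (Ici (H y)).indicator fun t => Real.exp (-t) := rfl
      rw [this, setIntegral_indicator measurableSet_Ici]
      rcases (h0 y).eq_or_lt with h | h
      · rw [← h, inter_eq_left.2 Ioi_subset_Ici_self, integral_exp_neg_Ioi]
      · rw [inter_eq_right.2 (Ici_subset_Ioi.2 h), integral_Ici_eq_integral_Ioi,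
          integral_exp_neg_Ioi]
    constructor
    · simpa only [hinner] using hfub.1.integral_prod_left
    · have h1 := integral_prod F hfub.1
      simp only [hinner] at h1
      rw [← h1, hfub.2, integral_mul_const, ← Real.Gamma_eq_integral hn,
        Real.Gamma_nat_eq_factorial]
  · filter_upwards [ae_restrict_mem measurableSet_Ioi] with t ht
    have ht : 0 < t := ht
    refine ⟨Eventually.of_forall fun y => ?_, ?_, ?_⟩
    · simp only [F, Pi.zero_apply]
      split_ifs <;> positivity
    · rw [hind, integrable_indicator_iff (hmeas t)]
      exact integrableOn_const (hlt t ht).ne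
    · rw [hind, integral_indicator_const _ (hmeas t), measureReal_def, hset t ht,
        ENNReal.toReal_mul, ENNReal.toReal_ofReal (pow_nonneg ht.le n), add_sub_cancel_right,
        Real.rpow_natCast, smul_eq_mul]
      ring

theorem volume_polarGauge_le_one_lt_top {q : Fin e → AddMonoidAlgebra ℝ (Fin n → ℤ)}
    {v : Fin e → ℝ} (hv : ∀ i, 0 < v i) {u : Fin n → ℝ}
    (hu : u ∈ interior (minkowskiNewton q v)) : volume {y | polarGauge q v u y ≤ 1} < ⊤ := by
  obtain ⟨r, hr, h⟩ := exists_polarGauge_ge hv hu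
  suffices hs : {y | polarGauge q v u y ≤ 1} ⊆ Metric.closedBall 0 r⁻¹ from
    (Metric.isBounded_closedBall.subset hs).measure_lt_top
  intro y hy
  rw [mem_closedBall_zero_iff, pi_norm_le_iff_of_nonneg (inv_nonneg.2 hr.le)]
  intro j
  have h1 : |y j| ≤ ∑ j, |y j| :=
    Finset.single_le_sum (fun j _ => abs_nonneg (y j)) (Finset.mem_univ j)
  have h2 := (h y).trans hy
  rw [Real.norm_eq_abs, ← one_div, le_div_iff₀ hr]
  nlinarith

theorem integral_exp_neg_polarGauge {q : Fin e → AddMonoidAlgebra ℝ (Fin n → ℤ)}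
    {v : Fin e → ℝ} (hv : ∀ i, 0 < v i) {u : Fin n → ℝ}
    (hu : u ∈ interior (minkowskiNewton q v)) :
    Integrable (fun y => Real.exp (-polarGauge q v u y)) ∧
      ∫ y, Real.exp (-polarGauge q v u y) =
        n.factorial * (volume {y | polarGauge q v u y ≤ 1}).toReal := by
  refine integral_exp_neg_gauge (measurable_polarGauge q v u) (fun y => ?_)
    (fun t ht y => polarGauge_smul q v u ht y) (volume_polarGauge_le_one_lt_top hv hu)
  obtain ⟨r, hr, h⟩ := exists_polarGauge_ge hv hu
  exact le_trans (by positivity) (h y)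

end Integrals

/-! ### The scaling limits -/

section Limits

variable {n e : ℕ}

/-- The point `(exp (-y_j / α))_j` of the torus. -/
noncomputable def expPoint (α : ℝ) (y : Fin n → ℝ) : Fin n → ℝ := fun j => Real.exp (-(y j / α))

theorem image_expPoint {α : ℝ} (hα : 0 < α) :
    expPoint α '' (univ : Set (Fin n → ℝ)) = orthant n := by
  ext x
  constructor
  · rintro ⟨y, -, rfl⟩ j
    exact Real.exp_pos _
  · intro hx
    refine ⟨fun j => -(α * Real.log (x j)), mem_univ _, funext fun j => ?_⟩
    simp only [expPoint]
    rw [neg_div, neg_neg, mul_div_cancel_left₀ _ hα.ne', Real.exp_log (hx j)]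

theorem expPoint_injective {α : ℝ} (hα : 0 < α) :
    Function.Injective (expPoint α : (Fin n → ℝ) → Fin n → ℝ) := by
  intro y z h
  funext j
  have := Real.exp_injective (congrFun h j)
  exact (div_left_inj' hα.ne').1 (neg_injective this)

/-- The change of variables `x = exp (-y / α)`. -/
theorem integral_orthant_eq {α : ℝ} (hα : 0 < α) (g : (Fin n → ℝ) → ℝ) :
    (IntegrableOn g (orthant n) ↔
      Integrable fun y => (∏ j, Real.exp (-(y j / α)) / α) * g (expPoint α y)) ∧
    ∫ x in orthant n, g x = ∫ y, (∏ j, Real.exp (-(y j / α)) / α) * g (expPoint α y) := by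
  let D : (Fin n → ℝ) → (Fin n → ℝ) →L[ℝ] (Fin n → ℝ) := fun y =>
    ContinuousLinearMap.pi fun j =>
      ((-(Real.exp (-(y j / α)) / α)) • ContinuousLinearMap.id ℝ ℝ) ∘SL
        (ContinuousLinearMap.proj j : (Fin n → ℝ) →L[ℝ] ℝ)
  have hD : ∀ y ∈ (univ : Set (Fin n → ℝ)), HasFDerivWithinAt (expPoint α) (D y) univ y := by
    intro y _
    refine HasFDerivAt.hasFDerivWithinAt (hasFDerivAt_pi.2 fun j => ?_)
    have h1 : HasDerivAt (fun t : ℝ => Real.exp (-(t / α)))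
        (Real.exp (-(y j / α)) * -(1 / α)) (y j) :=
      ((hasDerivAt_id' (y j)).div_const α).neg.exp
    have h2 := h1.hasFDerivAt.comp y
      (ContinuousLinearMap.proj j : (Fin n → ℝ) →L[ℝ] ℝ).hasFDerivAt
    refine h2.congr_fderiv (ContinuousLinearMap.ext fun z => ?_)
    simp only [ContinuousLinearMap.comp_apply, ContinuousLinearMap.proj_apply,
      ContinuousLinearMap.toSpanSingleton_apply, _root_.smul_apply,
      ContinuousLinearMap.id_apply, smul_eq_mul]
    ring
  have hdet : ∀ y, |(D y).det| = ∏ j, Real.exp (-(y j / α)) / α := by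
    intro y
    simp only [D]
    rw [ContinuousLinearMap.det_pi, Finset.abs_prod]
    refine Finset.prod_congr rfl fun j _ => ?_
    have : ((-(Real.exp (-(y j / α)) / α)) • ContinuousLinearMap.id ℝ ℝ).det =
        -(Real.exp (-(y j / α)) / α) := by
      rw [ContinuousLinearMap.det]
      simp
    rw [this, abs_neg, abs_of_pos (div_pos (Real.exp_pos _) hα)]
  have hinj := (expPoint_injective (n := n) hα).injOn (s := univ)
  rw [← image_expPoint hα]
  constructor
  · rw [integrableOn_image_iff_integrableOn_abs_det_fderiv_smul volume MeasurableSet.univ hD hinj,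
      integrableOn_univ]
    simp only [hdet, smul_eq_mul]
  · rw [integral_image_eq_integral_abs_det_fderiv_smul volume MeasurableSet.univ hD hinj,
      setIntegral_univ]
    simp only [hdet, smul_eq_mul]

theorem laurentEval_expPoint (q : AddMonoidAlgebra ℝ (Fin n → ℤ)) (α : ℝ) (y : Fin n → ℝ) :
    laurentEval q (expPoint α y) =
      ∑ ω ∈ q.coeff.support, q.coeff ω * Real.exp (-(y ⬝ᵥ toReal ω) / α) := by
  refine Finset.sum_congr rfl fun ω _ => ?_
  congr 1
  simp only [expPoint, ← Real.rpow_intCast, ← Real.exp_mul, ← Real.exp_sum]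
  congr 1
  simp only [dotProduct, toReal, ← Finset.sum_neg_distrib, Finset.sum_div]
  exact Finset.sum_congr rfl fun j _ => by ring

theorem laurentEval_pos {q : AddMonoidAlgebra ℝ (Fin n → ℤ)} (hq : IsPositiveLaurent q)
    {x : Fin n → ℝ} (hx : x ∈ orthant n) : 0 < laurentEval q x :=
  Finset.sum_pos (fun ω hω => mul_pos (hq.2 ω hω)
    (Finset.prod_pos fun j _ => zpow_pos (hx j) _)) hq.nonempty_support

/-- A sum of positive terms is at least its largest exponential times the smallest coefficient, and
at most that exponential times the sum of the coefficients. What matters is that both constants are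
independent of `α` and `y`. -/
theorem exists_laurentEval_bounds {q : AddMonoidAlgebra ℝ (Fin n → ℤ)}
    (hq : IsPositiveLaurent q) : ∃ m M : ℝ, 0 < m ∧ 0 < M ∧ ∀ α > 0, ∀ y,
      m * Real.exp (-newtonMin q y / α) ≤ laurentEval q (expPoint α y) ∧
      laurentEval q (expPoint α y) ≤ M * Real.exp (-newtonMin q y / α) := by
  obtain ⟨ω₀, hω₀, hmin⟩ :=
    Finset.exists_min_image q.coeff.support (fun ω => q.coeff ω) hq.nonempty_support
  refine ⟨q.coeff ω₀, ∑ ω ∈ q.coeff.support, q.coeff ω, hq.2 _ hω₀,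
    Finset.sum_pos hq.2 hq.nonempty_support, fun α hα y => ⟨?_, ?_⟩⟩
  · obtain ⟨ω, hω, hy⟩ := exists_newtonMin_eq hq y
    rw [laurentEval_expPoint, ← hy]
    refine le_trans (mul_le_mul_of_nonneg_right (hmin ω hω) (Real.exp_pos _).le) ?_
    exact Finset.single_le_sum
      (f := fun ω => q.coeff ω * Real.exp (-(y ⬝ᵥ toReal ω) / α))
      (fun ω hω => (mul_pos (hq.2 ω hω) (Real.exp_pos _)).le) hω
  · rw [laurentEval_expPoint, Finset.sum_mul]
    refine Finset.sum_le_sum fun ω hω => mul_le_mul_of_nonneg_left ?_ (hq.2 ω hω).le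
    refine Real.exp_le_exp.2 (div_le_div_of_nonneg_right ?_ hα.le)
    exact neg_le_neg (newtonMin_le y hω)

/-- The integrand of `∏ q_i^(-α v_i) x^(α u) dx/x` in the coordinates `x = exp (-y / α)`. -/
noncomputable def scaledIntegrand (q : Fin e → AddMonoidAlgebra ℝ (Fin n → ℤ)) (v : Fin e → ℝ)
    (u : Fin n → ℝ) (α : ℝ) (y : Fin n → ℝ) : ℝ :=
  (∏ i, laurentEval (q i) (expPoint α y) ^ (-(α * v i))) * Real.exp (-(y ⬝ᵥ u))

/-- The Jacobian cancels `dx/x` up to `α ^ (-n)`, and `x ^ (α u)` loses its dependence on `α`; only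
the factors `q_i ^ (-α v_i)` still involve it. -/
theorem powIntegrand_expPoint (q : Fin e → AddMonoidAlgebra ℝ (Fin n → ℤ)) (v : Fin e → ℝ)
    (u : Fin n → ℝ) {α : ℝ} (hα : 0 < α) (y : Fin n → ℝ) :
    (∏ j, Real.exp (-(y j / α)) / α) * powIntegrand q v u α (expPoint α y) =
      (α ^ n)⁻¹ * scaledIntegrand q v u α y := by
  have h1 : ∏ j, expPoint α y j ^ (α * u j) = Real.exp (-(y ⬝ᵥ u)) := by
    simp only [expPoint, ← Real.exp_mul, ← Real.exp_sum, dotProduct, ← Finset.sum_neg_distrib]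
    congr 1
    refine Finset.sum_congr rfl fun j _ => ?_
    field_simp
  have h2 : (∏ j, Real.exp (-(y j / α)) / α) * ∏ j, (expPoint α y j)⁻¹ = (α ^ n)⁻¹ := by
    rw [← Finset.prod_mul_distrib]
    have : ∀ j ∈ (Finset.univ : Finset (Fin n)),
        Real.exp (-(y j / α)) / α * (expPoint α y j)⁻¹ = α⁻¹ := fun j _ => by
      have := (Real.exp_pos (-(y j / α))).ne'
      simp only [expPoint]
      field_simp
    rw [Finset.prod_congr rfl this, Finset.prod_const, Finset.card_univ, Fintype.card_fin, inv_pow]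
  rw [powIntegrand, scaledIntegrand, h1, ← h2]
  ring

theorem measurable_laurentEval (q : AddMonoidAlgebra ℝ (Fin n → ℤ)) :
    Measurable (laurentEval q) := by
  refine Finset.measurable_sum _ fun ω _ => Measurable.const_mul ?_ _
  refine Finset.measurable_prod _ fun j _ => ?_
  exact (measurable_pi_apply j).pow_const (ω j)

theorem measurable_expPoint (α : ℝ) : Measurable (expPoint α : (Fin n → ℝ) → Fin n → ℝ) := by
  unfold expPoint
  fun_prop

theorem measurable_scaledIntegrand (q : Fin e → AddMonoidAlgebra ℝ (Fin n → ℤ)) (v : Fin e → ℝ)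
    (u : Fin n → ℝ) (α : ℝ) : Measurable (scaledIntegrand q v u α) := by
  refine Measurable.mul (Finset.measurable_prod _ fun i _ => ?_) ?_
  · exact ((measurable_laurentEval (q i)).comp (measurable_expPoint α)).pow_const _
  · have : Continuous fun y : Fin n → ℝ => Real.exp (-(y ⬝ᵥ u)) :=
      Real.continuous_exp.comp (Continuous.dotProduct continuous_id continuous_const).neg
    exact this.measurable

theorem scaledIntegrand_bounds {q : Fin e → AddMonoidAlgebra ℝ (Fin n → ℤ)} {v : Fin e → ℝ}
    (hv : ∀ i, 0 < v i) {m M : Fin e → ℝ} (hm : ∀ i, 0 < m i) (hM : ∀ i, 0 < M i)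
    (hb : ∀ i, ∀ α > 0, ∀ y, m i * Real.exp (-newtonMin (q i) y / α) ≤
        laurentEval (q i) (expPoint α y) ∧
      laurentEval (q i) (expPoint α y) ≤ M i * Real.exp (-newtonMin (q i) y / α))
    (u : Fin n → ℝ) {α : ℝ} (hα : 0 < α) (y : Fin n → ℝ) :
    (∏ i, M i ^ (-(α * v i))) * Real.exp (-polarGauge q v u y) ≤ scaledIntegrand q v u α y ∧
      scaledIntegrand q v u α y ≤
        (∏ i, m i ^ (-(α * v i))) * Real.exp (-polarGauge q v u y) := by
  have key : ∀ c : Fin e → ℝ, (∀ i, 0 < c i) →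
      (∏ i, c i ^ (-(α * v i))) * Real.exp (-polarGauge q v u y) =
        (∏ i, (c i * Real.exp (-newtonMin (q i) y / α)) ^ (-(α * v i))) *
          Real.exp (-(y ⬝ᵥ u)) := by
    intro c hc
    simp only [Real.mul_rpow (hc _).le (Real.exp_pos _).le, Finset.prod_mul_distrib,
      ← Real.exp_mul, ← Real.exp_sum, mul_assoc, ← Real.exp_add]
    congr 2
    rw [polarGauge, neg_sub, sub_eq_add_neg]
    congr 1
    refine Finset.sum_congr rfl fun i _ => ?_
    field_simp
  rw [key M hM, key m hm, scaledIntegrand]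
  have hpos : ∀ i, 0 < m i * Real.exp (-newtonMin (q i) y / α) := fun i =>
    mul_pos (hm i) (Real.exp_pos _)
  have hneg : ∀ i, -(α * v i) ≤ 0 := fun i => (neg_neg_of_pos (mul_pos hα (hv i))).le
  have hlpos : ∀ i, 0 < laurentEval (q i) (expPoint α y) := fun i =>
    (hpos i).trans_le (hb i α hα y).1
  constructor
  · refine mul_le_mul_of_nonneg_right (Finset.prod_le_prod (fun i _ => ?_) fun i _ => ?_)
      (Real.exp_pos _).le
    · exact Real.rpow_nonneg (mul_pos (hM i) (Real.exp_pos _)).le _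
    · exact Real.rpow_le_rpow_of_nonpos (hlpos i) (hb i α hα y).2 (hneg i)
  · refine mul_le_mul_of_nonneg_right (Finset.prod_le_prod (fun i _ => ?_) fun i _ => ?_)
      (Real.exp_pos _).le
    · exact Real.rpow_nonneg (hlpos i).le _
    · exact Real.rpow_le_rpow_of_nonpos (hpos i) (hb i α hα y).1 (hneg i)

theorem tendsto_prod_rpow {c : Fin e → ℝ} (hc : ∀ i, 0 < c i) (v : Fin e → ℝ) :
    Tendsto (fun α : ℝ => ∏ i, c i ^ (-(α * v i))) (𝓝[>] 0) (𝓝 1) := by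
  have h : Continuous fun α : ℝ => ∏ i, c i ^ (-(α * v i)) := by
    refine continuous_finsetProd _ fun i _ => ?_
    exact Continuous.rpow continuous_const (by fun_prop) fun _ => Or.inl (hc i).ne'
  have := h.tendsto 0
  simp only [zero_mul, neg_zero, Real.rpow_zero, Finset.prod_const_one] at this
  exact this.mono_left nhdsWithin_le_nhds

/-- Integrability and scaling limit of the product of powers. -/
theorem powIntegrand_limit {q : Fin e → AddMonoidAlgebra ℝ (Fin n → ℤ)}
    (hq : ∀ i, IsPositiveLaurent (q i)) {v : Fin e → ℝ} (hv : ∀ i, 0 < v i) (u : Fin n → ℝ)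
    (hH : Integrable fun y => Real.exp (-polarGauge q v u y)) :
    (∀ α : ℝ, 0 < α → IntegrableOn (powIntegrand q v u α) (orthant n)) ∧
      Tendsto (fun α : ℝ => α ^ n * ∫ x in orthant n, powIntegrand q v u α x) (𝓝[>] 0)
        (𝓝 (∫ y, Real.exp (-polarGauge q v u y))) := by
  choose m M hm hM hb using fun i => exists_laurentEval_bounds (hq i)
  have hint : ∀ α : ℝ, 0 < α → Integrable (scaledIntegrand q v u α) := by
    intro α hα
    refine (hH.const_mul (∏ i, m i ^ (-(α * v i)))).mono'
      (measurable_scaledIntegrand q v u α).aestronglyMeasurable (Eventually.of_forall fun y => ?_)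
    have h := scaledIntegrand_bounds hv hm hM hb u hα y
    rw [Real.norm_of_nonneg]
    · exact h.2
    · refine le_trans (mul_nonneg (Finset.prod_nonneg fun i _ => ?_) (Real.exp_pos _).le) h.1
      exact Real.rpow_nonneg (hM i).le _
  have heq : ∀ α : ℝ, 0 < α → α ^ n * ∫ x in orthant n, powIntegrand q v u α x =
      ∫ y, scaledIntegrand q v u α y := by
    intro α hα
    rw [(integral_orthant_eq hα _).2]
    simp only [powIntegrand_expPoint q v u hα]
    rw [integral_const_mul, mul_inv_cancel_left₀ (pow_pos hα n).ne']
  refine ⟨fun α hα => ?_, ?_⟩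
  · rw [(integral_orthant_eq hα _).1]
    simp only [powIntegrand_expPoint q v u hα]
    exact (hint α hα).const_mul _
  · have hl := (tendsto_prod_rpow hM v).mul_const (∫ y, Real.exp (-polarGauge q v u y))
    have hr := (tendsto_prod_rpow hm v).mul_const (∫ y, Real.exp (-polarGauge q v u y))
    rw [one_mul] at hl hr
    refine tendsto_of_tendsto_of_tendsto_of_le_of_le' hl hr ?_ ?_
    · filter_upwards [self_mem_nhdsWithin] with α hα
      rw [heq α hα, ← integral_const_mul]
      exact integral_mono (hH.const_mul _) (hint α hα) fun y =>
        (scaledIntegrand_bounds hv hm hM hb u hα y).1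
    · filter_upwards [self_mem_nhdsWithin] with α hα
      rw [heq α hα, ← integral_const_mul]
      exact integral_mono (hint α hα) (hH.const_mul _) fun y =>
        (scaledIntegrand_bounds hv hm hM hb u hα y).2

theorem orthant_eq_pi (m : ℕ) : orthant m = Set.pi univ fun _ => Ioi 0 := by
  ext x
  simp [orthant]

theorem measurableSet_orthant (m : ℕ) : MeasurableSet (orthant m) := by
  rw [orthant_eq_pi]
  exact MeasurableSet.univ_pi fun _ => measurableSet_Ioi

theorem restrict_orthant (m : ℕ) : (volume : Measure (Fin m → ℝ)).restrict (orthant m) =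
    Measure.pi fun _ => volume.restrict (Ioi 0) := by
  rw [orthant_eq_pi, volume_pi, Measure.restrict_pi_pi]

/-- Integrating out the variables `y_i` leads from the exponential integral to the product of
powers. -/
theorem integral_expIntegrand {q : Fin e → AddMonoidAlgebra ℝ (Fin n → ℤ)}
    (hq : ∀ i, IsPositiveLaurent (q i)) {v : Fin e → ℝ} (hv : ∀ i, 0 < v i) (u : Fin n → ℝ)
    {α : ℝ} (hα : 0 < α) (hpow : IntegrableOn (powIntegrand q v u α) (orthant n)) :
    IntegrableOn (expIntegrand q v u α) (orthant e ×ˢ orthant n) ∧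
      ∫ z in orthant e ×ˢ orthant n, expIntegrand q v u α z =
        (∏ i, Real.Gamma (α * v i)) * ∫ x in orthant n, powIntegrand q v u α x := by
  have hmeas : Measurable (expIntegrand q v u α) := by
    have h1 : ∀ i, Measurable fun z : (Fin e → ℝ) × (Fin n → ℝ) => laurentEval (q i) z.2 :=
      fun i => (measurable_laurentEval (q i)).comp measurable_snd
    unfold expIntegrand
    refine Measurable.mul (Measurable.mul (Measurable.mul ?_ ?_) ?_) ?_
    · refine Real.measurable_exp.comp (Finset.measurable_sum _ fun i _ => ?_).neg
      exact Measurable.mul (by fun_prop) (h1 i)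
    · exact Finset.measurable_prod _ fun i _ => Measurable.pow_const (by fun_prop) _
    · exact Finset.measurable_prod _ fun i _ => Measurable.pow_const (by fun_prop) _
    · fun_prop
  rw [IntegrableOn, Measure.volume_eq_prod, ← Measure.prod_restrict, ← integral_const_mul]
  refine integrable_and_integral_prod_of_nonneg hmeas.aestronglyMeasurable ?_ (hpow.const_mul _)
  filter_upwards [ae_restrict_mem (measurableSet_orthant n)] with x hx
  have hqx : ∀ i, 0 < laurentEval (q i) x := fun i => laurentEval_pos (hq i) hx
  let C : ℝ := (∏ j, x j ^ (α * u j)) * ∏ j, (x j)⁻¹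
  have heq : ∀ s ∈ orthant e, expIntegrand q v u α (s, x) =
      C * ∏ i, (s i ^ (α * v i - 1) * Real.exp (-(laurentEval (q i) x * s i))) := by
    intro s hs
    simp only [expIntegrand, Finset.prod_mul_distrib, ← Real.exp_sum, C]
    have h1 : ∏ i, s i ^ (α * v i - 1) = (∏ i, s i ^ (α * v i)) * ∏ i, (s i)⁻¹ := by
      rw [← Finset.prod_mul_distrib]
      refine Finset.prod_congr rfl fun i _ => ?_
      rw [Real.rpow_sub_one (hs i).ne', div_eq_mul_inv]
    rw [h1, ← Finset.sum_neg_distrib]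
    simp only [mul_comm (laurentEval _ _)]
    ring
  have hae : (fun s => expIntegrand q v u α (s, x)) =ᵐ[volume.restrict (orthant e)] fun s =>
      C * ∏ i, (s i ^ (α * v i - 1) * Real.exp (-(laurentEval (q i) x * s i))) := by
    filter_upwards [ae_restrict_mem (measurableSet_orthant e)] with s hs using heq s hs
  have hval : ∀ i, ∫ t in Ioi 0, t ^ (α * v i - 1) * Real.exp (-(laurentEval (q i) x * t)) =
      laurentEval (q i) x ^ (-(α * v i)) * Real.Gamma (α * v i) := fun i => by
    rw [Real.integral_rpow_mul_exp_neg_mul_Ioi (mul_pos hα (hv i)) (hqx i), one_div,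
      Real.inv_rpow (hqx i).le, Real.rpow_neg (hqx i).le]
  have hint1 : ∀ i, IntegrableOn
      (fun t => t ^ (α * v i - 1) * Real.exp (-(laurentEval (q i) x * t))) (Ioi 0) := fun i => by
    refine Integrable.of_integral_ne_zero ?_
    rw [hval i]
    exact (mul_pos (Real.rpow_pos_of_pos (hqx i) _)
      (Real.Gamma_pos_of_pos (mul_pos hα (hv i)))).ne'
  refine ⟨?_, ?_, ?_⟩
  · filter_upwards [ae_restrict_mem (measurableSet_orthant e)] with s hs
    rw [Pi.zero_apply, heq s hs]
    refine mul_nonneg (mul_nonneg (Finset.prod_nonneg fun j _ => ?_)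
      (Finset.prod_nonneg fun j _ => ?_)) (Finset.prod_nonneg fun i _ => ?_)
    · exact Real.rpow_nonneg (hx j).le _
    · exact inv_nonneg.2 (hx j).le
    · exact mul_nonneg (Real.rpow_nonneg (hs i).le _) (Real.exp_pos _).le
  · rw [integrable_congr hae, restrict_orthant]
    exact (Integrable.fintype_prod hint1).const_mul C
  · rw [integral_congr_ae hae, restrict_orthant, integral_const_mul,
      integral_fintype_prod_eq_prod fun i t =>
        t ^ (α * v i - 1) * Real.exp (-(laurentEval (q i) x * t)),
      Finset.prod_congr rfl fun i _ => hval i, Finset.prod_mul_distrib, powIntegrand]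
    simp only [C]
    ring

theorem expIntegrand_limit {q : Fin e → AddMonoidAlgebra ℝ (Fin n → ℤ)}
    (hq : ∀ i, IsPositiveLaurent (q i)) {v : Fin e → ℝ} (hv : ∀ i, 0 < v i) (u : Fin n → ℝ)
    (hH : Integrable fun y => Real.exp (-polarGauge q v u y)) :
    (∀ α : ℝ, 0 < α → IntegrableOn (expIntegrand q v u α) (orthant e ×ˢ orthant n)) ∧
      Tendsto (fun α : ℝ => (∏ i, v i) * (α ^ (n + e) *
          ∫ z in orthant e ×ˢ orthant n, expIntegrand q v u α z)) (𝓝[>] 0)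
        (𝓝 (∫ y, Real.exp (-polarGauge q v u y))) := by
  obtain ⟨hint, hlim⟩ := powIntegrand_limit hq hv u hH
  refine ⟨fun α hα => (integral_expIntegrand hq hv u hα (hint α hα)).1, ?_⟩
  -- The factor `α ^ e ∏ v_i` is absorbed by the functional equation of `Γ`, leaving a product
  -- continuous at `α = 0` with value `1`.
  have hG : Tendsto (fun α : ℝ => ∏ i, Real.Gamma (α * v i + 1)) (𝓝[>] 0) (𝓝 1) := by
    have : ∀ i, Tendsto (fun α : ℝ => Real.Gamma (α * v i + 1)) (𝓝[>] 0) (𝓝 1) := by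
      intro i
      have hc : ContinuousAt Real.Gamma (0 * v i + 1) := by
        rw [zero_mul, zero_add]
        exact (Real.differentiableAt_Gamma fun m h => by
          have : (0 : ℝ) ≤ m := m.cast_nonneg
          linarith).continuousAt
      have h2 : Tendsto (fun α : ℝ => α * v i + 1) (𝓝 0) (𝓝 (0 * v i + 1)) :=
        (by fun_prop : Continuous fun α : ℝ => α * v i + 1).tendsto 0
      have := hc.tendsto.comp h2
      rw [zero_mul, zero_add, Real.Gamma_one] at this
      exact this.mono_left nhdsWithin_le_nhds
    simpa using tendsto_finsetProd Finset.univ fun i _ => this i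
  have h := hG.mul hlim
  rw [one_mul] at h
  refine h.congr' ?_
  filter_upwards [self_mem_nhdsWithin] with α hα
  have hα : 0 < α := hα
  rw [(integral_expIntegrand hq hv u hα (hint α hα)).2]
  have : ∏ i, Real.Gamma (α * v i + 1) =
      α ^ e * (∏ i, v i) * ∏ i, Real.Gamma (α * v i) := by
    simp only [Real.Gamma_add_one (mul_pos hα (hv _)).ne', Finset.prod_mul_distrib,
      Finset.prod_const, Finset.card_univ, Fintype.card_fin]
  rw [this, pow_add]
  ring

end Limits

/-! ### Coordinates with respect to a simplex -/

section Simplex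

open scoped Classical

variable {ι : Type*} [Fintype ι]

/-- The vectors of a simplex `σ` in the order of the columns of its matrix. -/
noncomputable def simplexVertex (σ : Finset (ι → ℤ)) (k : ι) : ι → ℤ :=
  if h : Fintype.card ι = Fintype.card σ then (Fintype.equivOfCardEq h k : σ) else 0

/-- The coordinate of `X` at the vector `a` in the basis `σ`, a linear form in `X`. -/
noncomputable def vertexCoord (σ : Finset (ι → ℤ)) (a : ι → ℤ) : (ι → ℝ) →ₗ[ℝ] ℝ :=
  ∑ k, if simplexVertex σ k = a then
    LinearMap.proj k ∘ₗ Matrix.toLin' (simplexMatrix σ)⁻¹ else 0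

variable {A σ : Finset (ι → ℤ)}

theorem IsSimplex.card_eq (h : IsSimplex A σ) : Fintype.card ι = Fintype.card σ := by
  rw [Fintype.card_coe, h.2.1]

theorem IsSimplex.simplexVertex_mem (h : IsSimplex A σ) (k : ι) : simplexVertex σ k ∈ σ := by
  rw [simplexVertex, dif_pos h.card_eq]
  exact Subtype.coe_prop _

theorem IsSimplex.simplexVertex_injective (h : IsSimplex A σ) :
    Function.Injective (simplexVertex σ) := by
  intro k l hkl
  simp only [simplexVertex, dif_pos h.card_eq] at hkl
  exact (Fintype.equivOfCardEq h.card_eq).injective (Subtype.ext hkl)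

theorem IsSimplex.image_simplexVertex (h : IsSimplex A σ) :
    Finset.univ.image (simplexVertex σ) = σ := by
  refine Finset.eq_of_subset_of_card_le ?_ ?_
  · intro a ha
    obtain ⟨k, -, rfl⟩ := Finset.mem_image.1 ha
    exact h.simplexVertex_mem k
  · rw [Finset.card_image_of_injective _ h.simplexVertex_injective, Finset.card_univ, h.2.1]

theorem IsSimplex.exists_simplexVertex (h : IsSimplex A σ) {a : ι → ℤ} (ha : a ∈ σ) :
    ∃ k, simplexVertex σ k = a := by
  rw [← h.image_simplexVertex] at ha
  simpa using ha

theorem IsSimplex.simplexMatrix_apply (h : IsSimplex A σ) (i k : ι) :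
    simplexMatrix σ i k = toReal (simplexVertex σ k) i := by
  rw [simplexMatrix, dif_pos h.card_eq, simplexVertex, dif_pos h.card_eq]
  rfl

theorem IsSimplex.isUnit_det (h : IsSimplex A σ) : IsUnit (simplexMatrix σ).det :=
  isUnit_iff_ne_zero.2 h.2.2

theorem IsSimplex.vertexCoord_simplexVertex (h : IsSimplex A σ) (k : ι) (X : ι → ℝ) :
    vertexCoord σ (simplexVertex σ k) X = simplexCoord σ X k := by
  simp only [vertexCoord, LinearMap.sum_apply]
  rw [Finset.sum_eq_single k]
  · simp [simplexCoord]
  · intro l _ hl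
    rw [if_neg fun hkl => hl (h.simplexVertex_injective hkl), LinearMap.zero_apply]
  · simp

theorem IsSimplex.sum_eq (h : IsSimplex A σ) {M : Type*} [AddCommMonoid M] (f : (ι → ℤ) → M) :
    ∑ a ∈ σ, f a = ∑ k, f (simplexVertex σ k) := by
  conv_lhs => rw [← h.image_simplexVertex]
  exact Finset.sum_image h.simplexVertex_injective.injOn

theorem IsSimplex.prod_eq (h : IsSimplex A σ) {M : Type*} [CommMonoid M] (f : (ι → ℤ) → M) :
    ∏ a ∈ σ, f a = ∏ k, f (simplexVertex σ k) := by
  conv_lhs => rw [← h.image_simplexVertex]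
  exact Finset.prod_image h.simplexVertex_injective.injOn

theorem IsSimplex.mulVec_eq (h : IsSimplex A σ) (c : ι → ℝ) :
    (simplexMatrix σ).mulVec c = ∑ k, c k • toReal (simplexVertex σ k) := by
  ext i
  simp [Matrix.mulVec, dotProduct, h.simplexMatrix_apply, mul_comm]

theorem IsSimplex.sum_vertexCoord_smul (h : IsSimplex A σ) (X : ι → ℝ) :
    ∑ a ∈ σ, vertexCoord σ a X • toReal a = X := by
  rw [h.sum_eq]
  simp only [h.vertexCoord_simplexVertex]
  rw [← h.mulVec_eq, simplexCoord, Matrix.mulVec_mulVec, Matrix.mul_nonsing_inv _ h.isUnit_det,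
    Matrix.one_mulVec]

theorem IsSimplex.vertexCoord_sum (h : IsSimplex A σ) (c : (ι → ℤ) → ℝ) {a : ι → ℤ}
    (ha : a ∈ σ) : vertexCoord σ a (∑ b ∈ σ, c b • toReal b) = c a := by
  obtain ⟨k, rfl⟩ := h.exists_simplexVertex ha
  rw [h.vertexCoord_simplexVertex, h.sum_eq, ← h.mulVec_eq fun k => c (simplexVertex σ k),
    simplexCoord, Matrix.mulVec_mulVec, Matrix.nonsing_inv_mul _ h.isUnit_det, Matrix.one_mulVec]

theorem IsSimplex.vertexCoord_toReal (h : IsSimplex A σ) {a b : ι → ℤ} (ha : a ∈ σ)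
    (hb : b ∈ σ) : vertexCoord σ a (toReal b) = if a = b then 1 else 0 := by
  rw [← h.vertexCoord_sum (fun x => if x = b then 1 else 0) ha]
  congr 1
  simp [hb]

theorem IsSimplex.mem_cone_iff (h : IsSimplex A σ) {ρ : Finset (ι → ℤ)} (hρ : ρ ⊆ σ)
    (X : ι → ℝ) : X ∈ cone ρ ↔
      ∀ a ∈ σ, 0 ≤ vertexCoord σ a X ∧ (a ∉ ρ → vertexCoord σ a X = 0) := by
  constructor
  · intro hX
    refine Submodule.span_induction
      (p := fun x _ => ∀ a ∈ σ, 0 ≤ vertexCoord σ a x ∧ (a ∉ ρ → vertexCoord σ a x = 0))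
      ?_ ?_ ?_ ?_ hX
    · rintro _ ⟨b, hb, rfl⟩ a ha
      rw [h.vertexCoord_toReal ha (hρ hb)]
      refine ⟨by split_ifs <;> norm_num, fun hn => if_neg ?_⟩
      rintro rfl
      exact hn hb
    · intro a _
      simp
    · intro x y _ _ hx hy a ha
      rw [map_add]
      exact ⟨add_nonneg (hx a ha).1 (hy a ha).1, fun hn => by
        rw [(hx a ha).2 hn, (hy a ha).2 hn, add_zero]⟩
    · intro t x _ hx a ha
      have : vertexCoord σ a (t • x) = (t : ℝ) * vertexCoord σ a x :=
        (vertexCoord σ a).map_smul (t : ℝ) x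
      rw [this]
      exact ⟨mul_nonneg t.2 (hx a ha).1, fun hn => by rw [(hx a ha).2 hn, mul_zero]⟩
  · intro hX
    rw [← h.sum_vertexCoord_smul X]
    refine Submodule.sum_mem (PointedCone.hull ℝ (toReal '' (ρ : Set (ι → ℤ)))) fun a ha => ?_
    by_cases hn : a ∈ ρ
    · exact smul_mem_cone (toReal_mem_cone hn) (hX a ha).1
    · rw [(hX a ha).2 hn, zero_smul]
      exact Submodule.zero_mem _

theorem IsSimplex.mem_cone_self_iff (h : IsSimplex A σ) (X : ι → ℝ) :
    X ∈ cone σ ↔ ∀ a ∈ σ, 0 ≤ vertexCoord σ a X := by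
  rw [h.mem_cone_iff Subset.rfl]
  exact forall₂_congr fun a ha => ⟨fun hX => hX.1, fun hX => ⟨hX, fun hn => (hn ha).elim⟩⟩

theorem IsSimplex.mem_facetHyperplane (h : IsSimplex A σ) {a : ι → ℤ} {X : ι → ℝ}
    (hX : vertexCoord σ a X = 0) : X ∈ facetHyperplane σ a := by
  rw [← h.sum_vertexCoord_smul X]
  refine Submodule.sum_mem _ fun b hb => ?_
  by_cases hba : b = a
  · rw [hba, hX, zero_smul]
    exact Submodule.zero_mem _
  · refine Submodule.smul_mem _ _ (Submodule.subset_span (toReal_mem_cone ?_))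
    convert Finset.mem_erase.2 ⟨hba, hb⟩

theorem IsSimplex.dotProduct_eq (h : IsSimplex A σ) (φ X : ι → ℝ) :
    φ ⬝ᵥ X = ∑ a ∈ σ, vertexCoord σ a X * (φ ⬝ᵥ toReal a) := by
  conv_lhs => rw [← h.sum_vertexCoord_smul X]
  simp only [dotProduct_sum, dotProduct_smul, smul_eq_mul]

/-- Two simplices with a common facet: the coordinates at the opposite vertices are
proportional. -/
theorem IsSimplex.vertexCoord_eq_mul {σ' : Finset (ι → ℤ)} (h : IsSimplex A σ)
    (h' : IsSimplex A σ') {a b : ι → ℤ} (ha : a ∈ σ) (hb : b ∈ σ')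
    (hab : σ.erase a = σ'.erase b) (X : ι → ℝ) :
    vertexCoord σ a X = vertexCoord σ a (toReal b) * vertexCoord σ' b X := by
  conv_lhs => rw [← h'.sum_vertexCoord_smul X]
  rw [map_sum, Finset.sum_eq_single b]
  · rw [map_smul, smul_eq_mul, mul_comm]
  · intro c hc hcb
    have hcσ : c ∈ σ.erase a := hab ▸ Finset.mem_erase.2 ⟨hcb, hc⟩
    rw [map_smul, h.vertexCoord_toReal ha (Finset.mem_of_mem_erase hcσ),
      if_neg (Finset.ne_of_mem_erase hcσ).symm, smul_zero]
  · exact fun hn => (hn hb).elim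

/-- Two simplices with a common facet: the coordinates of a point in the hyperplane spanned by the
facet agree. -/
theorem IsSimplex.vertexCoord_eq_of_eq_zero {σ' : Finset (ι → ℤ)} (h : IsSimplex A σ)
    (h' : IsSimplex A σ') {a b : ι → ℤ} (ha : a ∈ σ) (hb : b ∈ σ')
    (hab : σ.erase a = σ'.erase b) {Y : ι → ℝ} (hY : vertexCoord σ a Y = 0) {c : ι → ℤ}
    (hc : c ∈ σ.erase a) : vertexCoord σ' c Y = vertexCoord σ c Y := by
  have hc' : c ∈ σ'.erase b := hab ▸ hc
  have hsum : ∑ x ∈ σ', (if x = b then 0 else vertexCoord σ x Y) • toReal x = Y := by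
    conv_rhs => rw [← h.sum_vertexCoord_smul Y]
    rw [← Finset.add_sum_erase σ _ ha, ← Finset.add_sum_erase σ' _ hb, hY, if_pos rfl, zero_smul,
      zero_smul, hab]
    congr 1
    exact Finset.sum_congr rfl fun x hx => by rw [if_neg (Finset.ne_of_mem_erase hx)]
  have := h'.vertexCoord_sum (fun x => if x = b then 0 else vertexCoord σ x Y)
    (Finset.mem_of_mem_erase hc')
  rw [hsum, if_neg (Finset.ne_of_mem_erase hc')] at this
  exact this

theorem continuous_vertexCoord (σ : Finset (ι → ℤ)) (a : ι → ℤ) :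
    Continuous (vertexCoord σ a) :=
  LinearMap.continuous_of_finiteDimensional _

end Simplex

/-! ### Adjacent simplices of a triangulation -/

section Triangulation

open scoped Classical

variable {ι : Type*} [Fintype ι] {A : Finset (ι → ℤ)} {T : Finset (Finset (ι → ℤ))}

/-- A point common to two simplicial cones lies in the cone over their common vertices, so its
coordinates at all other vertices vanish. -/
theorem IsTriangulation.mem_of_vertexCoord_ne_zero (hT : IsTriangulation A T)
    {σ σ' : Finset (ι → ℤ)} (hσ : σ ∈ T) (hσ' : σ' ∈ T) {X : ι → ℝ} (hX : X ∈ cone σ)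
    (hX' : X ∈ cone σ') {a : ι → ℤ} (ha : a ∈ σ) (hne : vertexCoord σ a X ≠ 0) : a ∈ σ' := by
  have hm : X ∈ cone (σ ∩ σ') := by
    have := hT.inter σ hσ σ' hσ'
    rw [← this]
    exact ⟨hX, hX'⟩
  by_contra hn
  refine hne ((((hT.isSimplex σ hσ).mem_cone_iff ?_ X).1 hm a ha).2 fun h => ?_)
  · exact Finset.inter_subset_left
  · exact hn (Finset.mem_of_mem_inter_right h)

theorem IsTriangulation.eq_of_vertexCoord_pos (hT : IsTriangulation A T)
    {σ σ' : Finset (ι → ℤ)} (hσ : σ ∈ T) (hσ' : σ' ∈ T) {X : ι → ℝ} (hX' : X ∈ cone σ')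
    (hpos : ∀ a ∈ σ, 0 < vertexCoord σ a X) : σ = σ' := by
  refine Finset.eq_of_subset_of_card_le (fun a ha => ?_) ?_
  · exact hT.mem_of_vertexCoord_ne_zero hσ hσ'
      (((hT.isSimplex σ hσ).mem_cone_self_iff X).2 fun a ha => (hpos a ha).le) hX' ha
      (hpos a ha).ne'
  · rw [(hT.isSimplex σ hσ).2.1, (hT.isSimplex σ' hσ').2.1]

/-- Two simplices on the same side of a common facet are equal. -/
theorem IsTriangulation.eq_of_same_side (hT : IsTriangulation A T) {σ σ' : Finset (ι → ℤ)}
    (hσ : σ ∈ T) (hσ' : σ' ∈ T) {a b : ι → ℤ} (ha : a ∈ σ)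
    (hab : σ.erase a = σ'.erase b) (hpos : 0 < vertexCoord σ' b (toReal a)) : σ = σ' := by
  have h := hT.isSimplex σ hσ
  have h' := hT.isSimplex σ' hσ'
  -- A point in the relative interior of the common facet. Moving it slightly towards `a` enters the
  -- interior of the cone of `σ'` and stays in that of `σ`, so the two simplices coincide.
  let y : ι → ℝ := ∑ c ∈ σ', (if c = b then 0 else 1 : ℝ) • toReal c
  have hy : ∀ c ∈ σ', vertexCoord σ' c y = if c = b then 0 else 1 := fun c hc =>
    h'.vertexCoord_sum (fun c => if c = b then 0 else 1) hc
  have hyσ : ∀ c ∈ σ, 0 ≤ vertexCoord σ c y := by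
    intro c hc
    rw [map_sum]
    refine Finset.sum_nonneg fun d hd => ?_
    by_cases hdb : d = b
    · simp [hdb]
    · have hdσ : d ∈ σ.erase a := hab ▸ Finset.mem_erase.2 ⟨hdb, hd⟩
      rw [if_neg hdb, one_smul, h.vertexCoord_toReal hc (Finset.mem_of_mem_erase hdσ)]
      split_ifs <;> norm_num
  have hev : ∀ᶠ t : ℝ in 𝓝[>] 0, ∀ c ∈ σ', 0 < vertexCoord σ' c (y + t • toReal a) := by
    rw [Filter.eventually_all_finset]
    intro c hc
    by_cases hcb : c = b
    · filter_upwards [self_mem_nhdsWithin] with t ht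
      rw [map_add, hy c hc, if_pos hcb, map_smul, zero_add, smul_eq_mul, hcb]
      exact mul_pos ht hpos
    · have hcont : Continuous fun t : ℝ => vertexCoord σ' c (y + t • toReal a) :=
        (continuous_vertexCoord σ' c).comp (by fun_prop)
      have h0 : 0 < vertexCoord σ' c (y + (0 : ℝ) • toReal a) := by
        rw [zero_smul, add_zero, hy c hc, if_neg hcb]
        exact one_pos
      exact (hcont.continuousAt.eventually (lt_mem_nhds h0)).filter_mono nhdsWithin_le_nhds
  obtain ⟨t, ht, ht0⟩ := (hev.and self_mem_nhdsWithin).exists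
  refine (hT.eq_of_vertexCoord_pos hσ' hσ ((h.mem_cone_self_iff _).2 fun c hc => ?_) ht).symm
  rw [map_add, map_smul, h.vertexCoord_toReal hc ha]
  refine add_nonneg (hyσ c hc) (mul_nonneg (le_of_lt ht0) ?_)
  split_ifs <;> norm_num

/-- `σ'` is the neighbour of `σ` across a facet whose hyperplane contains `Y`. -/
def AdjacentAt (Y : ι → ℝ) (σ σ' : Finset (ι → ℤ)) : Prop :=
  ∃ a ∈ σ, ∃ b ∈ σ', vertexCoord σ a Y = 0 ∧ vertexCoord σ' b Y = 0 ∧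
    σ.erase a = σ'.erase b ∧ vertexCoord σ a (toReal b) < 0

/-- A wall through an interior point of the cone is not on its boundary, so the far side is covered
too. Step from the facet away from `a`: a simplex reached by arbitrarily small steps is the
neighbour. -/
theorem IsTriangulation.exists_adjacentAt (hT : IsTriangulation A T) {Y : ι → ℝ}
    (hY : Y ∈ interior (cone A)) {σ : Finset (ι → ℤ)} (hσ : σ ∈ T) {a : ι → ℤ} (ha : a ∈ σ)
    (haY : vertexCoord σ a Y = 0) : ∃ σ' ∈ T, AdjacentAt Y σ σ' := by
  have h := hT.isSimplex σ hσ
  let y : ι → ℝ := ∑ c ∈ σ, (if c = a then 0 else 1 : ℝ) • toReal c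
  have hy : ∀ c ∈ σ, vertexCoord σ c y = if c = a then 0 else 1 := fun c hc =>
    h.vertexCoord_sum (fun c => if c = a then 0 else 1) hc
  -- A form in the polar cone vanishing at `y` vanishes on every vertex of `σ` except `a`, hence at
  -- `Y`, whose coordinate at `a` is zero; so it is zero.
  have hyint : y ∈ interior (cone A) := by
    refine mem_interior_cone_iff.2 fun φ hφ h0 => ?_
    have hφY := mem_interior_cone_iff.1 hY φ hφ h0
    have hnn : ∀ c ∈ σ, 0 ≤ vertexCoord σ c y * (φ ⬝ᵥ toReal c) := fun c hc => by
      rw [hy c hc]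
      exact mul_nonneg (by split_ifs <;> norm_num) (hφ c (h.1 hc))
    rw [h.dotProduct_eq φ y]
    refine lt_of_le_of_ne (Finset.sum_nonneg hnn) fun hs => hφY.ne' ?_
    rw [h.dotProduct_eq φ Y]
    refine Finset.sum_eq_zero fun c hc => ?_
    by_cases hca : c = a
    · rw [hca, haY, zero_mul]
    · have := (Finset.sum_eq_zero_iff_of_nonneg hnn).1 hs.symm c hc
      rw [hy c hc, if_neg hca, one_mul] at this
      rw [this, mul_zero]
  have hev : ∀ᶠ t : ℝ in 𝓝[>] 0, y + t • (-toReal a) ∈ cone A :=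
    (eventually_add_smul_mem_interior hyint _).filter_mono nhdsWithin_le_nhds
  -- Finitely many cones cover the points with small `t > 0`, so one of them is met for arbitrarily
  -- small `t`; being closed, it also contains `y`.
  obtain ⟨σ', hσ', hfreq⟩ : ∃ σ' ∈ T, ∃ᶠ t : ℝ in 𝓝[>] 0, y + t • (-toReal a) ∈ cone σ' := by
    by_contra hcon
    push Not at hcon
    have hall : ∀ᶠ t : ℝ in 𝓝[>] 0, ∀ σ' ∈ T, y + t • (-toReal a) ∉ cone σ' := by
      rw [Filter.eventually_all_finset]
      exact hcon
    obtain ⟨t, ht, ht'⟩ := (hev.and hall).exists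
    rw [← hT.cover] at ht
    simp only [mem_iUnion] at ht
    obtain ⟨σ', hσ', hm⟩ := ht
    exact ht' σ' hσ' hm
  have h' := hT.isSimplex σ' hσ'
  have hyσ' : y ∈ cone σ' := by
    rw [h'.mem_cone_self_iff]
    intro c hc
    by_contra hneg
    have hcont : Continuous fun t : ℝ => vertexCoord σ' c (y + t • (-toReal a)) :=
      (continuous_vertexCoord σ' c).comp (by fun_prop)
    have h0 : vertexCoord σ' c (y + (0 : ℝ) • (-toReal a)) < 0 := by
      rw [zero_smul, add_zero]
      exact not_le.1 hneg
    have := (hcont.continuousAt.eventually (gt_mem_nhds h0)).filter_mono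
      (nhdsWithin_le_nhds (s := Ioi 0))
    obtain ⟨t, ht, ht'⟩ := (hfreq.and_eventually this).exists
    exact ht'.not_ge ((h'.mem_cone_self_iff _).1 ht c hc)
  have hyσ : y ∈ cone σ := (h.mem_cone_self_iff y).2 fun c hc => by
    rw [hy c hc]
    split_ifs <;> norm_num
  have hsub : σ.erase a ⊆ σ' := fun c hc => by
    refine hT.mem_of_vertexCoord_ne_zero hσ hσ' hyσ hyσ' (Finset.mem_of_mem_erase hc) ?_
    rw [hy c (Finset.mem_of_mem_erase hc), if_neg (Finset.ne_of_mem_erase hc)]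
    exact one_ne_zero
  obtain ⟨b, hb⟩ : ∃ b, σ' \ σ.erase a = {b} := by
    rw [← Finset.card_eq_one, Finset.card_sdiff_of_subset hsub, Finset.card_erase_of_mem ha, h.2.1,
      h'.2.1]
    have : 0 < Fintype.card ι := h.2.1 ▸ Finset.card_pos.2 ⟨a, ha⟩
    omega
  have hbm : b ∈ σ' \ σ.erase a := hb ▸ Finset.mem_singleton_self b
  rw [Finset.mem_sdiff] at hbm
  have hab : σ.erase a = σ'.erase b := by
    rw [← Finset.sdiff_sdiff_eq_self hsub, hb, Finset.sdiff_singleton_eq_erase]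
  obtain ⟨t, ht, ht0⟩ := (hfreq.and_eventually self_mem_nhdsWithin).exists
  have ht0 : 0 < t := ht0
  -- At `y - t a` the coordinate at `a` is `-t`, and it equals `vertexCoord σ a (toReal b)` times a
  -- nonnegative coordinate in `σ'`.
  have hneg : vertexCoord σ a (toReal b) < 0 := by
    have h1 := h.vertexCoord_eq_mul h' ha hbm.1 hab (y + t • (-toReal a))
    rw [map_add, hy a ha, if_pos rfl, map_smul, map_neg, h.vertexCoord_toReal ha ha, if_pos rfl,
      zero_add, smul_eq_mul] at h1
    have h2 := (h'.mem_cone_self_iff _).1 ht b hbm.1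
    by_contra hge
    have := mul_nonneg (not_lt.1 hge) h2
    linarith
  refine ⟨σ', hσ', a, ha, b, hbm.1, haY, ?_, hab, hneg⟩
  have := h.vertexCoord_eq_mul h' ha hbm.1 hab Y
  rw [haY] at this
  exact (mul_eq_zero.1 this.symm).resolve_left hneg.ne

/-- No simplex has two vanishing coordinates at `Y`. -/
def IsGenericAt (T : Finset (Finset (ι → ℤ))) (Y : ι → ℝ) : Prop :=
  ∀ σ ∈ T, ∀ a ∈ σ, ∀ b ∈ σ, vertexCoord σ a Y = 0 → vertexCoord σ b Y = 0 → a = b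

/-- Genericity makes the wall of `σ'` through `Y` unique, so both crossings use the same facet. Two
sign changes put `σ` and `σ''` on the same side of it. -/
theorem IsTriangulation.adjacentAt_adjacentAt (hT : IsTriangulation A T) {Y : ι → ℝ}
    (hg : IsGenericAt T Y) {σ σ' σ'' : Finset (ι → ℤ)} (hσ : σ ∈ T) (hσ' : σ' ∈ T)
    (hσ'' : σ'' ∈ T) (h : AdjacentAt Y σ σ') (h' : AdjacentAt Y σ' σ'') : σ = σ'' := by
  obtain ⟨a, ha, b, hb, haY, hbY, hab, hneg⟩ := h
  obtain ⟨b', hb', d, hd, hbY', hdY, hbd, hneg'⟩ := h'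
  obtain rfl := hg σ' hσ' b hb b' hb' hbY hbY'
  refine hT.eq_of_same_side hσ hσ'' ha (hab.trans hbd) ?_
  have h1 := (hT.isSimplex σ hσ).vertexCoord_eq_mul (hT.isSimplex σ' hσ') ha hb hab (toReal a)
  have h2 := (hT.isSimplex σ' hσ').vertexCoord_eq_mul (hT.isSimplex σ'' hσ'') hb hd hbd (toReal a)
  rw [(hT.isSimplex σ hσ).vertexCoord_toReal ha ha, if_pos rfl] at h1
  have h3 : vertexCoord σ' b (toReal a) < 0 := by
    by_contra hge
    have := mul_nonpos_of_nonpos_of_nonneg hneg.le (not_lt.1 hge)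
    linarith
  by_contra hle
  have := mul_nonneg_of_nonpos_of_nonpos hneg'.le (not_lt.1 hle)
  linarith

end Triangulation

/-! ### The signed sum of dual cones of a triangulation -/

section SignedSum

open scoped Classical

variable {ι : Type*} [Fintype ι] {A : Finset (ι → ℤ)} {T : Finset (Finset (ι → ℤ))}

/-- The sign of a real number, as a real number. -/
noncomputable def realSign (x : ℝ) : ℝ := (SignType.sign x : SignType)

theorem realSign_of_pos {x : ℝ} (hx : 0 < x) : realSign x = 1 := by simp [realSign, hx]

theorem realSign_of_neg {x : ℝ} (hx : x < 0) : realSign x = -1 := by simp [realSign, hx]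

theorem realSign_zero : realSign 0 = 0 := by simp [realSign]

theorem realSign_mul (x y : ℝ) : realSign (x * y) = realSign x * realSign y := by
  simp [realSign, sign_mul]

theorem eventually_realSign_eq {X : Type*} [TopologicalSpace X] {f : X → ℝ} {x : X}
    (hf : ContinuousAt f x) (hx : f x ≠ 0) : ∀ᶠ y in 𝓝 x, realSign (f y) = realSign (f x) := by
  rcases hx.lt_or_gt with h | h
  · filter_upwards [hf.eventually (gt_mem_nhds h)] with y hy
    rw [realSign_of_neg h, realSign_of_neg hy]
  · filter_upwards [hf.eventually (lt_mem_nhds h)] with y hy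
    rw [realSign_of_pos h, realSign_of_pos hy]

/-- The product of `ε_a + sgn p_{σa}(X)` over the vertices of `σ`. For `ε_a = sgn ⟨φ, a⟩` it is
`±2^d` if `φ` lies in the open signed dual cone of `σ`, and `0` otherwise. -/
noncomputable def signWeight (ε : (ι → ℤ) → ℝ) (σ : Finset (ι → ℤ)) (X : ι → ℝ) : ℝ :=
  ∏ a ∈ σ, (ε a + realSign (vertexCoord σ a X))

/-- Wall crossing. Near `Y` only simplices with a wall through `Y` can change weight; adjacency
pairs them off, and the changes within each pair are opposite. No assumption on `ε` is needed. -/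
theorem IsTriangulation.eventually_sum_signWeight_eq (hT : IsTriangulation A T) {Y : ι → ℝ}
    (hY : Y ∈ interior (cone A)) (hg : IsGenericAt T Y) (ε : (ι → ℤ) → ℝ) :
    ∀ᶠ X in 𝓝 Y, ∑ σ ∈ T, signWeight ε σ X = ∑ σ ∈ T, signWeight ε σ Y := by
  have hev : ∀ᶠ X in 𝓝 Y, ∀ σ ∈ T, ∀ a ∈ σ, vertexCoord σ a Y ≠ 0 →
      realSign (vertexCoord σ a X) = realSign (vertexCoord σ a Y) := by
    simp only [Filter.eventually_all_finset]
    intro σ _ a _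
    by_cases h0 : vertexCoord σ a Y = 0
    · exact Eventually.of_forall fun X hn => (hn h0).elim
    · exact (eventually_realSign_eq (continuous_vertexCoord σ a).continuousAt h0).mono
        fun X hX _ => hX
  filter_upwards [hev] with X hX
  rw [← sub_eq_zero, ← Finset.sum_sub_distrib]
  -- By genericity only the factor at `a` varies, from `ε a` at `Y` to `ε a` plus a sign at `X`, so
  -- the difference is that sign times the remaining product.
  have hdiff : ∀ σ ∈ T, ∀ a ∈ σ, vertexCoord σ a Y = 0 →
      signWeight ε σ X - signWeight ε σ Y =
        realSign (vertexCoord σ a X) *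
          ∏ c ∈ σ.erase a, (ε c + realSign (vertexCoord σ c Y)) := by
    intro σ hσ a ha h0
    have : ∏ c ∈ σ.erase a, (ε c + realSign (vertexCoord σ c X)) =
        ∏ c ∈ σ.erase a, (ε c + realSign (vertexCoord σ c Y)) := by
      refine Finset.prod_congr rfl fun c hc => ?_
      rw [hX σ hσ c (Finset.mem_of_mem_erase hc) fun hc0 => Finset.ne_of_mem_erase hc
        (hg σ hσ c (Finset.mem_of_mem_erase hc) a ha hc0 h0)]
    rw [signWeight, signWeight, ← Finset.mul_prod_erase σ _ ha, ← Finset.mul_prod_erase σ _ ha,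
      this, h0, realSign_zero]
    ring
  let B := T.filter fun σ => ∃ a ∈ σ, vertexCoord σ a Y = 0
  have hBsum : ∑ σ ∈ B, (signWeight ε σ X - signWeight ε σ Y) =
      ∑ σ ∈ T, (signWeight ε σ X - signWeight ε σ Y) := by
    refine Finset.sum_subset (Finset.filter_subset _ _) fun σ hσ hσB => ?_
    have hne : ∀ a ∈ σ, vertexCoord σ a Y ≠ 0 := fun a ha h0 =>
      hσB (Finset.mem_filter.2 ⟨hσ, a, ha, h0⟩)
    rw [signWeight, signWeight, sub_eq_zero]
    exact Finset.prod_congr rfl fun a ha => by rw [hX σ hσ a ha (hne a ha)]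
  rw [← hBsum]
  have hadj : ∀ σ ∈ B, ∃ σ' ∈ T, AdjacentAt Y σ σ' := by
    intro σ hσ
    obtain ⟨hσT, a, ha, h0⟩ := Finset.mem_filter.1 hσ
    exact hT.exists_adjacentAt hY hσT ha h0
  choose g hgT hgadj using hadj
  have hgB : ∀ σ (hσ : σ ∈ B), g σ hσ ∈ B := fun σ hσ => by
    obtain ⟨a, -, b, hb, -, hb0, -⟩ := hgadj σ hσ
    exact Finset.mem_filter.2 ⟨hgT σ hσ, b, hb, hb0⟩
  have hBT : ∀ {σ}, σ ∈ B → σ ∈ T := fun hσ => (Finset.mem_filter.1 hσ).1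
  refine Finset.sum_involution g ?_ ?_ hgB fun σ hσ => ?_
  -- The neighbours have equal remaining products, since their coordinates at `Y` agree on the
  -- common facet, and opposite signs at the vertices facing it.
  · intro σ hσ
    obtain ⟨a, ha, b, hb, ha0, hb0, hab, hneg⟩ := hgadj σ hσ
    have h := hT.isSimplex σ (hBT hσ)
    have h' := hT.isSimplex _ (hgT σ hσ)
    have hprod : ∏ c ∈ σ.erase a, (ε c + realSign (vertexCoord (g σ hσ) c Y)) =
        ∏ c ∈ σ.erase a, (ε c + realSign (vertexCoord σ c Y)) :=
      Finset.prod_congr rfl fun c hc => by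
        rw [h.vertexCoord_eq_of_eq_zero h' ha hb hab ha0 hc]
    rw [hdiff σ (hBT hσ) a ha ha0, hdiff _ (hgT σ hσ) b hb hb0, ← hab, hprod,
      h.vertexCoord_eq_mul h' ha hb hab X, realSign_mul, realSign_of_neg hneg]
    ring
  · intro σ hσ _ heq
    obtain ⟨a, ha, b, hb, ha0, hb0, -, hneg⟩ := hgadj σ hσ
    rw [heq] at hb hb0
    obtain rfl := hg σ (hBT hσ) a ha b hb ha0 hb0
    rw [(hT.isSimplex σ (hBT hσ)).vertexCoord_toReal ha ha, if_pos rfl] at hneg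
    exact absurd hneg (by norm_num)
  · exact (hT.adjacentAt_adjacentAt hg (hBT hσ) (hgT σ hσ) (hgT _ (hgB σ hσ)) (hgadj σ hσ)
      (hgadj _ (hgB σ hσ))).symm

theorem ae_linearMap_ne_zero {l : (ι → ℝ) →ₗ[ℝ] ℝ} (hl : l ≠ 0) : ∀ᵐ x, l x ≠ 0 := by
  have h := Measure.addHaar_submodule volume (LinearMap.ker l)
    fun h => hl (LinearMap.ker_eq_top.1 h)
  rw [ae_iff]
  convert h using 2
  ext x
  simp

/-- A segment between generic points of the interior of the cone. -/
theorem IsTriangulation.sum_signWeight_eq_of_segment (hT : IsTriangulation A T) {X X' : ι → ℝ}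
    (hX : X ∈ interior (cone A)) (hX' : X' ∈ interior (cone A))
    (hdet : ∀ σ ∈ T, ∀ a ∈ σ, ∀ b ∈ σ, a ≠ b →
      vertexCoord σ a X * vertexCoord σ b X' - vertexCoord σ b X * vertexCoord σ a X' ≠ 0)
    (ε : (ι → ℤ) → ℝ) : ∑ σ ∈ T, signWeight ε σ X = ∑ σ ∈ T, signWeight ε σ X' := by
  let p : ℝ → ι → ℝ := fun t => (1 - t) • X + t • X'
  have hp : Continuous p := by fun_prop
  let f : unitInterval → ℝ := fun t => ∑ σ ∈ T, signWeight ε σ (p t)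
  have hf : IsLocallyConstant f := by
    rw [IsLocallyConstant.iff_eventually_eq]
    intro t
    have hpt : p t ∈ interior (cone A) :=
      (convex_cone A).interior hX hX' (sub_nonneg.2 t.2.2) t.2.1 (sub_add_cancel _ _)
    -- Two coordinates vanishing at the same point of the segment would make the vectors of their
    -- values at `X` and `X'` linearly dependent, so the determinant in `hdet` would vanish.
    have hgen : IsGenericAt T (p t) := by
      intro σ hσ a ha b hb ha0 hb0
      by_contra hab
      simp only [p, map_add, map_smul, smul_eq_mul] at ha0 hb0
      refine hdet σ hσ a ha b hb hab ?_
      have h1 : (1 - (t : ℝ)) * (vertexCoord σ a X * vertexCoord σ b X' -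
          vertexCoord σ b X * vertexCoord σ a X') = 0 := by
        linear_combination vertexCoord σ b X' * ha0 - vertexCoord σ a X' * hb0
      have h2 : (t : ℝ) * (vertexCoord σ a X * vertexCoord σ b X' -
          vertexCoord σ b X * vertexCoord σ a X') = 0 := by
        linear_combination vertexCoord σ a X * hb0 - vertexCoord σ b X * ha0
      linear_combination h1 + h2
    exact (hp.comp continuous_subtype_val).continuousAt.eventually
      (hT.eventually_sum_signWeight_eq hpt hgen ε)
  have h := hf.apply_eq_of_preconnectedSpace 0 1
  simpa [f, p] using h

/-- All `ε a` are `1`, so a negative coordinate kills its product. Only the unique simplex whose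
cone contains `X` survives, with every factor `2`. -/
theorem sum_signWeight_of_mem_polarCone (hT : IsTriangulation A T) {X φ : ι → ℝ}
    (hX : X ∈ cone A) (hgen : ∀ σ ∈ T, ∀ a ∈ σ, vertexCoord σ a X ≠ 0)
    (hφ : φ ∈ polarCone A) (hφg : ∀ σ ∈ T, ∀ a ∈ σ, φ ⬝ᵥ toReal a ≠ 0) :
    ∑ σ ∈ T, signWeight (fun a => realSign (φ ⬝ᵥ toReal a)) σ X = 2 ^ Fintype.card ι := by
  have hε : ∀ σ ∈ T, ∀ a ∈ σ, realSign (φ ⬝ᵥ toReal a) = 1 := fun σ hσ a ha =>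
    realSign_of_pos (lt_of_le_of_ne (hφ a ((hT.isSimplex σ hσ).1 ha)) (hφg σ hσ a ha).symm)
  have hX' := hX
  rw [← hT.cover] at hX'
  simp only [mem_iUnion] at hX'
  obtain ⟨σ₀, hσ₀, hm⟩ := hX'
  have hpos : ∀ a ∈ σ₀, 0 < vertexCoord σ₀ a X := fun a ha =>
    lt_of_le_of_ne (((hT.isSimplex σ₀ hσ₀).mem_cone_self_iff X).1 hm a ha) (hgen σ₀ hσ₀ a ha).symm
  rw [Finset.sum_eq_single σ₀]
  · rw [signWeight, ← (hT.isSimplex σ₀ hσ₀).2.1]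
    refine Finset.prod_eq_pow_card fun a ha => ?_
    rw [hε σ₀ hσ₀ a ha, realSign_of_pos (hpos a ha)]
    norm_num
  · intro σ hσ hne
    have hnm : X ∉ cone σ := fun h => hne (hT.eq_of_vertexCoord_pos hσ₀ hσ h hpos).symm
    rw [(hT.isSimplex σ hσ).mem_cone_self_iff] at hnm
    push Not at hnm
    obtain ⟨a, ha, hneg⟩ := hnm
    refine Finset.prod_eq_zero ha ?_
    beta_reduce
    rw [hε σ hσ a ha, realSign_of_neg hneg]
    norm_num
  · exact fun h => (h hσ₀).elim

/-- Since `⟨φ, X⟩` is the sum of the terms `p_{σa}(X) ⟨φ, a⟩`, some term is negative; its two signs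
are opposite and the corresponding factor vanishes. -/
theorem IsSimplex.signWeight_eq_zero {σ : Finset (ι → ℤ)} (h : IsSimplex A σ) {X φ : ι → ℝ}
    (hX : φ ⬝ᵥ X < 0) :
    signWeight (fun a => realSign (φ ⬝ᵥ toReal a)) σ X = 0 := by
  rw [h.dotProduct_eq] at hX
  obtain ⟨a, ha, hneg⟩ := Finset.exists_lt_of_sum_lt
    (hX.trans_eq (Finset.sum_const_zero (s := σ)).symm)
  refine Finset.prod_eq_zero ha ?_
  beta_reduce
  rcases mul_neg_iff.1 hneg with ⟨h1, h2⟩ | ⟨h1, h2⟩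
  · rw [realSign_of_pos h1, realSign_of_neg h2, neg_add_cancel]
  · rw [realSign_of_neg h1, realSign_of_pos h2, add_neg_cancel]

/-- Move `X` along a segment inside the cone to a point `Z` with `⟨φ, Z⟩ < 0`, where each weight
vanishes separately. Almost every `Z` gives a segment that avoids intersections of two walls of a
simplex. -/
theorem sum_signWeight_of_notMem_polarCone (hT : IsTriangulation A T) {X φ : ι → ℝ}
    (hX : X ∈ interior (cone A)) (hgen : ∀ σ ∈ T, ∀ a ∈ σ, vertexCoord σ a X ≠ 0)
    (hφ : φ ∉ polarCone A) :
    ∑ σ ∈ T, signWeight (fun a => realSign (φ ⬝ᵥ toReal a)) σ X = 0 := by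
  have hcont : Continuous fun Z : ι → ℝ => φ ⬝ᵥ Z :=
    Continuous.dotProduct continuous_const continuous_id
  have hU : IsOpen ({Z : ι → ℝ | φ ⬝ᵥ Z < 0} ∩ interior (cone A)) :=
    (isOpen_lt hcont continuous_const).inter isOpen_interior
  have hUne : ({Z : ι → ℝ | φ ⬝ᵥ Z < 0} ∩ interior (cone A)).Nonempty := by
    rw [mem_polarCone_iff] at hφ
    push Not at hφ
    obtain ⟨c, hc, hneg⟩ := hφ
    have hcl : c ∈ closure (interior (cone A)) := by
      rw [(convex_cone A).closure_interior_eq_closure_of_nonempty_interior ⟨X, hX⟩]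
      exact subset_closure hc
    exact mem_closure_iff.1 hcl _ (isOpen_lt hcont continuous_const) hneg
  have hae : ∀ᵐ Z : ι → ℝ, ∀ σ ∈ T, ∀ a ∈ σ, ∀ b ∈ σ, a ≠ b →
      vertexCoord σ a X * vertexCoord σ b Z - vertexCoord σ b X * vertexCoord σ a Z ≠ 0 := by
    simp only [Filter.eventually_all_finset]
    intro σ hσ a ha b hb
    have h := hT.isSimplex σ hσ
    by_cases hab : a = b
    · exact Eventually.of_forall fun Z hne => (hne hab).elim
    · refine (ae_linearMap_ne_zero (l := vertexCoord σ a X • vertexCoord σ b -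
        vertexCoord σ b X • vertexCoord σ a) fun h0 => ?_).mono fun Z hZ _ => hZ
      have := LinearMap.congr_fun h0 (toReal b)
      simp only [LinearMap.sub_apply, LinearMap.smul_apply, smul_eq_mul, LinearMap.zero_apply,
        h.vertexCoord_toReal hb hb, h.vertexCoord_toReal ha hb, if_neg hab, if_true, mul_one,
        mul_zero, sub_zero] at this
      exact hgen σ hσ a ha this
  obtain ⟨Z, ⟨hZneg, hZint⟩, hZ⟩ := (Measure.dense_of_ae hae).inter_open_nonempty _ hU hUne
  rw [hT.sum_signWeight_eq_of_segment hX hZint hZ]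
  exact Finset.sum_eq_zero fun σ hσ => (hT.isSimplex σ hσ).signWeight_eq_zero hZneg

/-! ### The dual volume of a triangulated cone -/

/-- Off `s = 0` the weight is `sgn p` times the indicator of the half-line where `s p > 0`, on which
the exponential decays; the sign turns `1 / |p|` into `1 / p`. -/
theorem integrable_and_integral_sign_exp {p : ℝ} (hp : p ≠ 0) :
    Integrable (fun s : ℝ => (realSign s + realSign p) / 2 * Real.exp (-(s * p))) ∧
      ∫ s : ℝ, (realSign s + realSign p) / 2 * Real.exp (-(s * p)) = 1 / p := by
  have key : ∀ p : ℝ, 0 < p →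
      Integrable (fun s : ℝ => (realSign s + realSign p) / 2 * Real.exp (-(s * p))) ∧
        ∫ s : ℝ, (realSign s + realSign p) / 2 * Real.exp (-(s * p)) = 1 / p := by
    intro p hp
    have hae : (fun s : ℝ => (realSign s + realSign p) / 2 * Real.exp (-(s * p))) =ᵐ[volume]
        fun s : ℝ => if -0 ≤ s then Real.exp (-(s * p)) else 0 := by
      filter_upwards [Measure.ae_ne volume (0 : ℝ)] with s hs
      rw [realSign_of_pos hp, neg_zero]
      rcases hs.lt_or_gt with h | h
      · rw [realSign_of_neg h, if_neg h.not_ge]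
        norm_num
      · rw [realSign_of_pos h, if_pos h.le]
        norm_num
    obtain ⟨h1, h2⟩ := integrable_and_integral_exp_neg_Ici hp 0
    refine ⟨h1.congr hae.symm, ?_⟩
    rw [integral_congr_ae hae, h2, mul_zero, Real.exp_zero, mul_one, one_div]
  rcases hp.lt_or_gt with h | h
  · obtain ⟨h1, h2⟩ := key (-p) (neg_pos.2 h)
    have hfun : (fun s : ℝ => (realSign s + realSign p) / 2 * Real.exp (-(s * p))) = fun s =>
        -((realSign (-s) + realSign (-p)) / 2 * Real.exp (-(-s * -p))) := by
      funext s
      have hn : ∀ x, realSign (-x) = -realSign x := fun x => by simp [realSign, Left.sign_neg]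
      rw [hn, hn, neg_mul_neg]
      ring
    rw [hfun]
    refine ⟨h1.comp_neg.neg, ?_⟩
    rw [integral_neg, integral_neg_eq_self fun s =>
      (realSign s + realSign (-p)) / 2 * Real.exp (-(s * -p)), h2, one_div, one_div, inv_neg,
      neg_neg]
  · exact key p h

/-- In the coordinates `s_k = ⟨φ, a_k⟩`, given by the transpose of `A_σ`, both the weight and `exp
(-⟨φ, X⟩)` are products over `k`, and the Jacobian supplies `1 / |det A_σ|`. -/
theorem IsSimplex.integral_signWeight {σ : Finset (ι → ℤ)} (h : IsSimplex A σ) {X : ι → ℝ}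
    (hgen : ∀ a ∈ σ, vertexCoord σ a X ≠ 0) :
    Integrable (fun φ : ι → ℝ => signWeight (fun a => realSign (φ ⬝ᵥ toReal a)) σ X /
        2 ^ Fintype.card ι * Real.exp (-(φ ⬝ᵥ X))) ∧
      ∫ φ : ι → ℝ, signWeight (fun a => realSign (φ ⬝ᵥ toReal a)) σ X /
        2 ^ Fintype.card ι * Real.exp (-(φ ⬝ᵥ X)) =
          1 / (∏ k, simplexCoord σ X k) * (1 / simplexAbsDet σ) := by
  have hp : ∀ k, simplexCoord σ X k ≠ 0 := fun k => by
    rw [← h.vertexCoord_simplexVertex]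
    exact hgen _ (h.simplexVertex_mem k)
  let L := Matrix.toLin' (simplexMatrix σ).transpose
  let g : (ι → ℝ) → ℝ := fun s => ∏ k, ((realSign (s k) + realSign (simplexCoord σ X k)) / 2 *
    Real.exp (-(s k * simplexCoord σ X k)))
  have hg : Integrable g :=
    Integrable.fintype_prod fun k => (integrable_and_integral_sign_exp (hp k)).1
  have hgval : ∫ s, g s = 1 / ∏ k, simplexCoord σ X k := by
    rw [integral_fintype_prod_volume_eq_prod fun k (s : ℝ) =>
      (realSign s + realSign (simplexCoord σ X k)) / 2 * Real.exp (-(s * simplexCoord σ X k)),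
      Finset.prod_congr rfl fun k _ => (integrable_and_integral_sign_exp (hp k)).2,
      Finset.prod_div_distrib, Finset.prod_const_one]
  have hLk : ∀ φ k, L φ k = φ ⬝ᵥ toReal (simplexVertex σ k) := fun φ k => by
    simp only [L, Matrix.toLin'_apply, Matrix.mulVec, dotProduct, Matrix.transpose_apply,
      h.simplexMatrix_apply]
    exact Finset.sum_congr rfl fun i _ => mul_comm _ _
  have hfun : (fun φ : ι → ℝ => signWeight (fun a => realSign (φ ⬝ᵥ toReal a)) σ X /
        2 ^ Fintype.card ι * Real.exp (-(φ ⬝ᵥ X))) = g ∘ L := by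
    funext φ
    simp only [Function.comp_apply, g, hLk, Finset.prod_mul_distrib, Finset.prod_div_distrib,
      Finset.prod_const, Finset.card_univ, ← Real.exp_sum]
    rw [signWeight, h.prod_eq, h.dotProduct_eq, h.sum_eq, Finset.sum_neg_distrib]
    simp only [h.vertexCoord_simplexVertex, mul_comm (simplexCoord σ X _)]
  have hdet : (simplexMatrix σ).transpose.det ≠ 0 := by
    rw [Matrix.det_transpose]
    exact h.2.2
  have hmap := Real.map_matrix_volume_pi_eq_smul_volume_pi hdet
  have hemb : MeasurableEmbedding L := by
    have hinj : Function.Injective L :=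
      Matrix.mulVec_injective_of_isUnit ((Matrix.isUnit_iff_isUnit_det _).2 hdet.isUnit)
    exact (LinearMap.continuous_of_finiteDimensional L).measurableEmbedding hinj
  rw [hfun]
  constructor
  · rw [← hemb.integrable_map_iff, hmap]
    exact hg.smul_measure ENNReal.ofReal_ne_top
  · have := hemb.integral_map (μ := volume) g
    change ∫ φ, g (L φ) = _
    rw [← this, hmap, integral_smul_measure, hgval, ENNReal.toReal_ofReal (abs_nonneg _),
      Matrix.det_transpose, smul_eq_mul, abs_inv, simplexAbsDet, one_div |_|, mul_comm]

/-- The formula for the dual volume in terms of a triangulation. -/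
theorem IsTriangulation.integral_polarCone (hT : IsTriangulation A T) {X : ι → ℝ}
    (hX : X ∈ interior (cone A)) (hgen : ∀ σ ∈ T, ∀ a ∈ σ, X ∉ facetHyperplane σ a) :
    ∫ φ in polarCone A, Real.exp (-(φ ⬝ᵥ X)) =
      ∑ σ ∈ T, 1 / (∏ k, simplexCoord σ X k) * (1 / simplexAbsDet σ) := by
  have hgen' : ∀ σ ∈ T, ∀ a ∈ σ, vertexCoord σ a X ≠ 0 := fun σ hσ a ha h0 =>
    hgen σ hσ a ha ((hT.isSimplex σ hσ).mem_facetHyperplane h0)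
  rw [Finset.sum_congr rfl fun σ hσ =>
    ((hT.isSimplex σ hσ).integral_signWeight (hgen' σ hσ)).2.symm,
    ← integral_finsetSum _ fun σ hσ =>
      ((hT.isSimplex σ hσ).integral_signWeight (hgen' σ hσ)).1,
    ← integral_indicator (measurableSet_polarCone A)]
  refine integral_congr_ae ?_
  -- The signed sum is `2 ^ d` on the polar cone only where no `⟨φ, a⟩` is zero; the excluded
  -- hyperplanes are null because vertices of a simplex are nonzero.
  have hae : ∀ᵐ φ : ι → ℝ, ∀ σ ∈ T, ∀ a ∈ σ, φ ⬝ᵥ toReal a ≠ 0 := by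
    simp only [Filter.eventually_all_finset]
    intro σ hσ a ha
    have h := hT.isSimplex σ hσ
    let l : (ι → ℝ) →ₗ[ℝ] ℝ :=
      { toFun := fun φ => φ ⬝ᵥ toReal a
        map_add' := fun x y => add_dotProduct x y _
        map_smul' := fun t x => smul_dotProduct t x _ }
    refine ae_linearMap_ne_zero (l := l) fun h0 => ?_
    have h1 : toReal a = 0 := dotProduct_self_eq_zero.1 (LinearMap.congr_fun h0 (toReal a))
    have h2 := h.vertexCoord_toReal ha ha
    rw [h1, map_zero, if_pos rfl] at h2
    exact zero_ne_one h2
  filter_upwards [hae] with φ hφ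
  rw [← Finset.sum_mul, ← Finset.sum_div]
  by_cases hm : φ ∈ polarCone A
  · rw [indicator_of_mem hm,
      sum_signWeight_of_mem_polarCone hT (interior_subset hX) hgen' hm hφ,
      div_self (by positivity), one_mul]
  · rw [indicator_of_notMem hm, sum_signWeight_of_notMem_polarCone hT hX hgen' hm, zero_div,
      zero_mul]

end SignedSum

end CayleyDual

theorem mainTheorem6 (n e : ℕ) (q : Fin e → AddMonoidAlgebra ℝ (Fin n → ℤ))
    (hq : ∀ i, CayleyDual.IsPositiveLaurent (q i))
    (hA : AddSubgroup.closure (CayleyDual.cayley q : Set (Fin e ⊕ Fin n → ℤ)) = ⊤)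
    (v : Fin e → ℝ) (hv : ∀ i, 0 < v i) (u : Fin n → ℝ) :
    (u ∈ interior (CayleyDual.minkowskiNewton q v) ↔
      Sum.elim v u ∈ interior (CayleyDual.cone (CayleyDual.cayley q))) ∧
    (u ∈ interior (CayleyDual.minkowskiNewton q v) →
      -- all the integrals and volumes are finite
      IntegrableOn (fun φ : Fin e ⊕ Fin n → ℝ => Real.exp (-(φ ⬝ᵥ Sum.elim v u)))
        (CayleyDual.dualCone (CayleyDual.cone (CayleyDual.cayley q)) (Sum.elim v u)) ∧
      (∀ α : ℝ, 0 < α → IntegrableOn (CayleyDual.expIntegrand q v u α)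
        (CayleyDual.orthant e ×ˢ CayleyDual.orthant n)) ∧
      (∀ α : ℝ, 0 < α → IntegrableOn (CayleyDual.powIntegrand q v u α) (CayleyDual.orthant n)) ∧
      volume (CayleyDual.polarDual
        (CayleyDual.translate (CayleyDual.minkowskiNewton q v) u)) < ⊤ ∧
      -- the exponential scaling limit
      Tendsto (fun α : ℝ => (∏ i, v i) * (α ^ (n + e) *
          ∫ z in CayleyDual.orthant e ×ˢ CayleyDual.orthant n, CayleyDual.expIntegrand q v u α z))
        (𝓝[>] 0)
        (𝓝 ((∏ i, v i) *
          CayleyDual.dualVolume (CayleyDual.cone (CayleyDual.cayley q)) (Sum.elim v u))) ∧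
      -- the scaling limit of the product of powers
      Tendsto (fun α : ℝ => α ^ n *
          ∫ x in CayleyDual.orthant n, CayleyDual.powIntegrand q v u α x)
        (𝓝[>] 0)
        (𝓝 ((∏ i, v i) *
          CayleyDual.dualVolume (CayleyDual.cone (CayleyDual.cayley q)) (Sum.elim v u))) ∧
      -- the volume of the polar dual
      (∏ i, v i) * CayleyDual.dualVolume (CayleyDual.cone (CayleyDual.cayley q)) (Sum.elim v u) =
        CayleyDual.normalizedVolume (CayleyDual.polarDual
          (CayleyDual.translate (CayleyDual.minkowskiNewton q v) u)) ∧
      -- the formula for a triangulation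
      (∀ T : Finset (Finset (Fin e ⊕ Fin n → ℤ)),
        CayleyDual.IsTriangulation (CayleyDual.cayley q) T →
        (∀ σ ∈ T, ∀ ω ∈ σ, Sum.elim v u ∉ CayleyDual.facetHyperplane σ ω) →
        CayleyDual.normalizedVolume (CayleyDual.polarDual
            (CayleyDual.translate (CayleyDual.minkowskiNewton q v) u)) =
          (∏ i, v i) * ∑ σ ∈ T,
            1 / (∏ k, CayleyDual.simplexCoord σ (Sum.elim v u) k) *
              (1 / CayleyDual.simplexAbsDet σ))) := by
  refine ⟨CayleyDual.mem_interior_iff_mem_interior_cone hq hv u, fun hu => ?_⟩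
  have hX := (CayleyDual.mem_interior_iff_mem_interior_cone hq hv u).1 hu
  obtain ⟨hH, hHval⟩ := CayleyDual.integral_exp_neg_polarGauge hv hu
  obtain ⟨hdual, hdualval⟩ := CayleyDual.integral_exp_neg_polarCone hq hv u hH
  -- After this rewriting both limits and the volume formula are statements about `∫ exp (-H)`.
  rw [CayleyDual.dualCone_eq_polarCone hX, CayleyDual.dualVolume_eq_integral_polarCone hX,
    CayleyDual.polarDual_translate_eq hq hv, hdualval]
  refine ⟨hdual, (CayleyDual.expIntegrand_limit hq hv u hH).1,
    (CayleyDual.powIntegrand_limit hq hv u hH).1, CayleyDual.volume_polarGauge_le_one_lt_top hv hu,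
    (CayleyDual.expIntegrand_limit hq hv u hH).2, (CayleyDual.powIntegrand_limit hq hv u hH).2,
    hHval, fun T hT hgen => ?_⟩
  rw [CayleyDual.normalizedVolume, ← hHval, ← hdualval, hT.integral_polarCone hX hgen]
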